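/- For $\lambda,\mu,k\in\mathbb C$ put $\delta=\mu-\lambda$ and let $\Psi^k_{\lambda,\mu}$ be the space of formal sums $dx^\delta\sum_{i\ge0}f_i(x)\,\partial_x^{k-i}$, $f_i\in\mathbb C[x]$, on which the Lie algebra of polynomial vector fields $g\,\partial_x$, $g\in\mathbb C[x]$, acts by $$g\partial_x\cdot dx^\delta f\partial_x^r=dx^\delta\Bigl\{\bigl(gf'+(\delta-r)g'f\bigr)\partial_x^r-f\sum_{s\ge1}\tbinom rs\Bigl(\lambda+\tfrac{r-s}{s+1}\Bigr)g^{(s+1)}\partial_x^{r-s}\Bigr\}.$$ Let $SQ^{k,l}_{\lambda,\mu}=\Psi^k_{\lambda,\mu}/\Psi^{k-l}_{\lambda,\mu}$; equivalence of such subquotients means isomorphism as modules of this Lie algebra. Put $\gamma=3(\lambda+\mu-1)^2$, $\gamma^{1/2}=\sqrt3\,(\lambda+\mu-1)$, $(x)_r=x(x-1)\cdots(x-r+1)$ and $$B_{m+2,m}=\gamma-\bigl[(2m+1)\delta+m^2+m+1\bigr],\qquad B_{m+3,m}=\gamma^{3/2}-3\gamma^{1/2}\bigl[(m+1)\delta+1\bigr],$$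 $$B_{m+4,m}=\gamma^2-\gamma\bigl[2(2m+3)\delta-(2m^2+6m-3)\bigr]-\tfrac35m(m+3)\bigl[2(2m+3)\delta+m^2+3m+6\bigr],$$ $$I_n=\frac{B_{n+4,n}}{B_{n+4,n+2}B_{n+2,n}},\quad J_n=\frac{B_{n+4,n}B_{n+3,n+1}}{B_{n+4,n+1}B_{n+3,n}},\quad K_n=\frac{B_{n+4,n+2}B_{n+3,n+1}B_{n+2,n}}{B_{n+4,n+1}B_{n+3,n}}.$$ Primes denote the same quantities at $(\lambda',\mu')$. The pair $(\lambda,\mu),(\lambda',\mu')$ satisfies the simultaneous vanishing condition (SVC) if each of the six functions $(\delta-n-j)_{i-j}B_{n+i,n+j}$, $0\le j\le i-2$, $2\le i\le4$, is either zero at both $(\lambda,\mu)$ and $(\lambda',\mu')$ or non-zero at both. **Theorem.** Let $n\in\mathbb C$ be non-resonant in length $5$, i.e. $n\notin\{0,-\frac12,-1,-\frac32,-2,-\frac52,-3\}$. (a) For all $\lambda,\mu,\lambda',\mu'\in\mathbb C$, the subquotients $SQ^{\delta-n,5}_{\lambda,\mu}$ and $SQ^{\delta'-n,5}_{\lambda',\mu'}$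 are equivalent if and only if they satisfy the SVC and either $(\delta-n)_4(\delta'-n)_4=0$, or $(\delta-n)_4(\delta'-n)_4\ne0$ and one of the following conditions holds, where the (non-)vanishing conditions refer to the values at $(\gamma,\delta)$: - (i) at least two of $B_{n+4,n}$, $B_{n+4,n+2}B_{n+2,n}$, $B_{n+4,n+1}B_{n+3,n}B_{n+3,n+1}$ are zero; - (ii) $B_{n+4,n}B_{n+4,n+2}B_{n+2,n}\ne0$, $B_{n+4,n+1}B_{n+3,n}B_{n+3,n+1}=0$, and $I_n(\gamma,\delta)=I_n(\gamma',\delta')$; - (iii) $B_{n+4,n}B_{n+4,n+1}B_{n+3,n}B_{n+3,n+1}\ne0$, $B_{n+4,n+2}B_{n+2,n}=0$, and $J_n(\gamma,\delta)=J_n(\gamma',\delta')$; - (iv) $B_{n+4,n+1}B_{n+3,n}B_{n+4,n+2}B_{n+3,n+1}B_{n+2,n}\ne0$, $B_{n+4,n}=0$, and $K_n(\gamma,\delta)=K_n(\gamma',\delta')$; - (v) all six $B_{n+i,n+j}$ are non-zero, $I_n(\gamma,\delta)=I_n(\gamma',\delta')$ and $J_n(\gamma,\delta)=J_n(\gamma',\delta')$.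 (b) The conditions (i)–(v) are mutually exclusive. (c) Call $(\lambda,\mu)$ generic if $(\delta-n)_4\ne0$ and all six $B_{n+i,n+j}$ are non-zero; this depends only on $(\gamma,\delta)$. If $(\lambda,\mu)$ and $(\lambda',\mu')$ are generic, then $SQ^{\delta-n,5}_{\lambda,\mu}$ and $SQ^{\delta'-n,5}_{\lambda',\mu'}$ are equivalent if and only if $I_n(\gamma,\delta)=I_n(\gamma',\delta')$ and $J_n(\gamma,\delta)=J_n(\gamma',\delta')$. (d) As polynomials in $(\gamma,\delta)$, $B_{n+4,n}$ and $B_{n+4,n+2}B_{n+2,n}$ span a pencil of conics, and $B_{n+4,n}B_{n+3,n+1}$ and $B_{n+4,n+1}B_{n+3,n}$ span a pencil of cubics (every non-trivial linear combination has total degree exactly $2$, respectively $3$). For generic $(\lambda,\mu)$, the set of all $(\gamma',\delta')\in\mathbb C^2$ with $SQ^{\delta'-n,5}_{\lambda',\mu'}$ equivalent to $SQ^{\delta-n,5}_{\lambda,\mu}$ is the set of generic points in the intersection of the conic of the first pencil through $(\gamma,\delta)$ and the cubic of the second pencil through $(\gamma,\delta)$. -/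

import Mathlib

open Polynomial

noncomputable section

namespace PseudoDiff

/-- The Lie algebra of polynomial vector fields on the line (complexified): the derivations
`g ∂` of `ℂ[x]`, with the commutator bracket. -/
abbrev Vec : Type := Derivation ℂ ℂ[X] ℂ[X]

/-- The coefficient `g` of the vector field `g ∂`. -/
def Vec.coeff (V : Vec) : ℂ[X] := V Polynomial.X

/-- The falling factorial `(x)_r = x (x - 1) ⋯ (x - r + 1)`. -/
def falling (x : ℂ) (r : ℕ) : ℂ := ∏ i ∈ Finset.range r, (x - i)

/-- The binomial coefficient `x` choose `s` for complex `x`. -/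
def binom (x : ℂ) (s : ℕ) : ℂ := falling x s / (s.factorial : ℂ)

/-- The difference `δ = μ - λ` of the two density degrees. -/
def del (lam mu : ℂ) : ℂ := mu - lam

/-- The underlying space of the module `Ψ^k_{λ,μ}` of pseudodifferential operators of order in
`k - ℕ`: the sequence `u` stands for the formal sum `dx^δ ∑ i, (u i) ∂^(k - i)`. -/
abbrev Psi : Type := ℕ → ℂ[X]

/-- The action `L_{λ,μ}(g ∂)` on `Ψ^k_{λ,μ}`. It is the (formal) linear extension of
`dx^δ f ∂^r ↦ dx^δ ((g f' + (δ - r) g' f) ∂^r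
  - f ∑ s ≥ 1, (r choose s) (λ + (r - s)/(s + 1)) g^(s+1) ∂^(r - s))`.
The coefficient of `∂^(k - i)` receives a contribution from `r = k - i` and, for `1 ≤ s ≤ i`,
from `r = k - i + s`, that is, from the entry `u (i - s)`. -/
def psiAction (k lam mu : ℂ) (V : Vec) : Psi →ₗ[ℂ] Psi where
  toFun u := fun i =>
    V.coeff * derivative (u i)
      + (del lam mu - (k - i)) • (derivative V.coeff * u i)
      - ∑ s ∈ Finset.Icc 1 i,
          (binom (k - i + s) s * (lam + (k - i) / ((s : ℂ) + 1))) •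
            (u (i - s) * derivative^[s + 1] V.coeff)
  map_add' u v := by
    funext i
    simp only [Pi.add_apply, derivative_add, mul_add, add_mul, smul_add, Finset.sum_add_distrib]
    ring
  map_smul' c u := by
    funext i
    simp only [Pi.smul_apply, derivative_smul, RingHom.id_apply, mul_smul_comm, smul_mul_assoc,
      smul_sub, smul_add, Finset.smul_sum]
    congr 1
    · rw [smul_comm c]
    · exact Finset.sum_congr rfl fun s _ => by rw [smul_comm c]

/-- The subspace `Ψ^(k - l)_{λ,μ}` of `Ψ^k_{λ,μ}`. -/
def lowerOrder (l : ℕ) : Submodule ℂ Psi where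
  carrier := {u | ∀ i < l, u i = 0}
  add_mem' hu hv i hi := by simp [hu i hi, hv i hi]
  zero_mem' _ _ := rfl
  smul_mem' c u hu i hi := by simp [hu i hi]

theorem lowerOrder_le_comap (k lam mu : ℂ) (l : ℕ) (V : Vec) :
    lowerOrder l ≤ (lowerOrder l).comap (psiAction k lam mu V) := by
  intro u hu i hi
  have h0 : ∀ j ≤ i, u j = 0 := fun j hj => hu j (lt_of_le_of_lt hj hi)
  simp [psiAction, h0 i le_rfl, h0 _ (Nat.sub_le i _)]

/-- The underlying space of the subquotient `SQ^{k,l}_{λ,μ} = Ψ^k_{λ,μ} / Ψ^(k - l)_{λ,μ}`. -/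
abbrev SQ (l : ℕ) : Type := Psi ⧸ lowerOrder l

/-- The action of vector fields on `SQ^{k,l}_{λ,μ}`. -/
def sqAction (k : ℂ) (l : ℕ) (lam mu : ℂ) (V : Vec) : SQ l →ₗ[ℂ] SQ l :=
  (lowerOrder l).mapQ (lowerOrder l) (psiAction k lam mu V) (lowerOrder_le_comap k lam mu l V)

/-- `SQ^{k,l}_{λ,μ}` and `SQ^{k',l}_{λ',μ'}` are equivalent (isomorphic) as modules of the Lie
algebra of polynomial vector fields. -/
def SQEquiv (l : ℕ) (k lam mu k' lam' mu' : ℂ) : Prop :=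
  ∃ φ : SQ l ≃ₗ[ℂ] SQ l, ∀ (V : Vec) (u : SQ l),
    φ (sqAction k l lam mu V u) = sqAction k' l lam' mu' V (φ u)

/-- `n` is resonant in length `l`: `n ∈ {0, -1/2, -1, -3/2, …, 2 - l}`. -/
def IsResonant (l : ℕ) (n : ℂ) : Prop := ∃ j : ℕ, j + 4 ≤ 2 * l ∧ n = -(j : ℂ) / 2

/-- The parameter `γ(λ,μ) = 3 (λ + μ - 1)²`. -/
def gam (lam mu : ℂ) : ℂ := 3 * (lam + mu - 1) ^ 2

/-- The chosen square root `γ^(1/2)(λ,μ) = √3 (λ + μ - 1)`. -/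
def gamSqrt (lam mu : ℂ) : ℂ := ((Real.sqrt 3 : ℝ) : ℂ) * (lam + mu - 1)

/-- The polynomial `B_{m+2,m}`. -/
def B₂ (m lam mu : ℂ) : ℂ :=
  gam lam mu - ((2 * m + 1) * del lam mu + (m ^ 2 + m + 1))

/-- The function `B_{m+3,m}`, a polynomial in `γ^(1/2)` and `δ`. -/
def B₃ (m lam mu : ℂ) : ℂ :=
  gamSqrt lam mu ^ 3 - 3 * gamSqrt lam mu * ((m + 1) * del lam mu + 1)

/-- The polynomial `B_{m+4,m}`. -/
def B₄ (m lam mu : ℂ) : ℂ :=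
  gam lam mu ^ 2
    - gam lam mu * (2 * (2 * m + 3) * del lam mu - (2 * m ^ 2 + 6 * m - 3))
    - 3 / 5 * m * (m + 3) * (2 * (2 * m + 3) * del lam mu + (m ^ 2 + 3 * m + 6))

/-- The value `f` at `(λ,μ)` and at `(λ',μ')` is either both times zero or both times nonzero. -/
def SimVanish (f : ℂ → ℂ → ℂ) (lam mu lam' mu' : ℂ) : Prop :=
  f lam mu = 0 ↔ f lam' mu' = 0

/-- The simultaneous vanishing condition in length 5, for the six functions
`(δ - n - j)_{i - j} B_{n+i,n+j}` with `0 ≤ j ≤ i - 2` and `2 ≤ i ≤ 4`. -/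
def SVC (n lam mu lam' mu' : ℂ) : Prop :=
  SimVanish (fun x y => falling (del x y - n) 2 * B₂ n x y) lam mu lam' mu' ∧
  SimVanish (fun x y => falling (del x y - n - 1) 2 * B₂ (n + 1) x y) lam mu lam' mu' ∧
  SimVanish (fun x y => falling (del x y - n - 2) 2 * B₂ (n + 2) x y) lam mu lam' mu' ∧
  SimVanish (fun x y => falling (del x y - n) 3 * B₃ n x y) lam mu lam' mu' ∧
  SimVanish (fun x y => falling (del x y - n - 1) 3 * B₃ (n + 1) x y) lam mu lam' mu' ∧
  SimVanish (fun x y => falling (del x y - n) 4 * B₄ n x y) lam mu lam' mu'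

/-- `I_n = B_{n+4,n} / (B_{n+4,n+2} B_{n+2,n})`. -/
def invI (n lam mu : ℂ) : ℂ := B₄ n lam mu / (B₂ (n + 2) lam mu * B₂ n lam mu)

/-- `J_n = B_{n+4,n} B_{n+3,n+1} / (B_{n+4,n+1} B_{n+3,n})`. -/
def invJ (n lam mu : ℂ) : ℂ :=
  B₄ n lam mu * B₂ (n + 1) lam mu / (B₃ (n + 1) lam mu * B₃ n lam mu)

/-- `K_n = B_{n+4,n+2} B_{n+3,n+1} B_{n+2,n} / (B_{n+4,n+1} B_{n+3,n})`. -/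
def invK (n lam mu : ℂ) : ℂ :=
  B₂ (n + 2) lam mu * B₂ (n + 1) lam mu * B₂ n lam mu / (B₃ (n + 1) lam mu * B₃ n lam mu)

/-- Condition (i): at least two of `B_{n+4,n}`, `B_{n+4,n+2} B_{n+2,n}` and
`B_{n+4,n+1} B_{n+3,n} B_{n+3,n+1}` are zero. -/
def CaseI (n lam mu : ℂ) : Prop :=
  (B₄ n lam mu = 0 ∧ B₂ (n + 2) lam mu * B₂ n lam mu = 0) ∨
  (B₄ n lam mu = 0 ∧ B₃ (n + 1) lam mu * B₃ n lam mu * B₂ (n + 1) lam mu = 0) ∨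
  (B₂ (n + 2) lam mu * B₂ n lam mu = 0 ∧
    B₃ (n + 1) lam mu * B₃ n lam mu * B₂ (n + 1) lam mu = 0)

/-- Condition (ii). -/
def CaseII (n lam mu lam' mu' : ℂ) : Prop :=
  B₄ n lam mu * B₂ (n + 2) lam mu * B₂ n lam mu ≠ 0 ∧
  B₃ (n + 1) lam mu * B₃ n lam mu * B₂ (n + 1) lam mu = 0 ∧
  invI n lam mu = invI n lam' mu'

/-- Condition (iii). -/
def CaseIII (n lam mu lam' mu' : ℂ) : Prop :=
  B₄ n lam mu * B₃ (n + 1) lam mu * B₃ n lam mu * B₂ (n + 1) lam mu ≠ 0 ∧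
  B₂ (n + 2) lam mu * B₂ n lam mu = 0 ∧
  invJ n lam mu = invJ n lam' mu'

/-- Condition (iv). -/
def CaseIV (n lam mu lam' mu' : ℂ) : Prop :=
  B₃ (n + 1) lam mu * B₃ n lam mu * B₂ (n + 2) lam mu * B₂ (n + 1) lam mu * B₂ n lam mu ≠ 0 ∧
  B₄ n lam mu = 0 ∧
  invK n lam mu = invK n lam' mu'

/-- Condition (v). -/
def CaseV (n lam mu lam' mu' : ℂ) : Prop :=
  B₄ n lam mu * B₃ (n + 1) lam mu * B₃ n lam mu * B₂ (n + 2) lam mu * B₂ (n + 1) lam mu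
    * B₂ n lam mu ≠ 0 ∧
  invI n lam mu = invI n lam' mu' ∧ invJ n lam mu = invJ n lam' mu'

/-- The generic locus: neither `(δ - n)_4` nor any of the six `B_{n+i,n+j}` vanishes. -/
def Generic (n lam mu : ℂ) : Prop :=
  falling (del lam mu - n) 4 ≠ 0 ∧
  B₄ n lam mu * B₃ (n + 1) lam mu * B₃ n lam mu * B₂ (n + 2) lam mu * B₂ (n + 1) lam mu
    * B₂ n lam mu ≠ 0

/-- The equivalence class `EC^l_n(γ,δ)` of `SQ^{δ-n,l}_{λ,μ}`, as a subset of the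
`(γ,δ)`-plane. -/
def EC (l : ℕ) (n lam mu : ℂ) : Set (ℂ × ℂ) :=
  {p | ∃ lam' mu' : ℂ, p = (gam lam' mu', del lam' mu') ∧
    SQEquiv l (del lam' mu' - n) lam' mu' (del lam mu - n) lam mu}

end PseudoDiff

end

/-!
Everything is reduced to a finite amount of linear algebra by the projective quantization.

The graded pieces of `SQ^{δ-n,5}` are the density modules `F_n, …, F_{n+4}`, where `g ∂` acts on
`F_a` by `u ↦ g u' + a g' u`. For non-resonant `n` the Casimir operator of the projective
subalgebra `⟨∂, x ∂, x² ∂⟩` separates them, so the filtration splits uniquely over that subalgebra.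
The splitting is explicit (`quantize`), and it carries the action to a model on `ℂ[x]⁵` in which
`g ∂` acts diagonally by the density actions plus terms `b i j • transvectant (i - j)` that depend
only on `g^(3)` (`quantMap_psiAction`). Comparing coefficients of `g^(p) u^(q)` shows that `b i j`
is, up to a non-zero factor depending on `n`, `i` and `j` alone,
`(δ - n - j)_{i - j} B_{n+i,n+j}`, and that it vanishes unless `i - j ≥ 2`.

An isomorphism between two models commutes with `∂` and `x ∂`, which makes it diagonal on constant
vectors, and with `x² ∂`, which makes it a fixed scalar on the relevant monomials of each component.
Commutation with `x³ ∂` then gives `p i * b i j = b' i j * p j`, and conversely every solution with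
all `p i ≠ 0` is an isomorphism (`exists_intertwiner_iff`).

Regard the pairs `(i, j)` with `i - j ≥ 2` as the edges of a graph on `{0, …, 4}`. It is the union
of the three paths `4-2-0`, `4-0` and `4-1-3-0`. A solution `p` exists exactly when the vanishing
patterns agree and a single ratio `p 4 / p 0` is compatible with every path free of vanishing edges
(`exists_diagonal_iff`). If `(δ - n)_4 = 0`, each path has a vanishing edge and nothing remains;
otherwise the falling factorials contribute the same factor to each path, and comparing the
paths two at a time gives the invariants `I`, `J` and `K` (`exists_scale_iff`).

For the pencils, `P` and `Q` have leading forms whose `γ²` coefficients are both `1` while only `Q`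
has `δ²`, with coefficient `(2n + 1)(2n + 5)`; the leading forms of `R` and `S` both have `γ³`
with coefficient `1`, and their `γδ²` coefficients differ by `n (n + 3)` up to sign. These
numbers are non-zero by non-resonance.
-/

noncomputable section

namespace PseudoDiff

/-! ### Coefficients of the projective quantization -/

/-- The coefficient of `∂^d : F_a → F_{a+d}` in the projective quantization of `Ψ_{λ,μ}`. It
solves the recursion expressing equivariance under `x² ∂`; the second factors of the denominators
vanish only at resonances. -/
def quantCoeff (lam mu a : ℂ) (d : ℕ) : ℂ :=
  ∏ r ∈ Finset.range d, ((del lam mu - a - r) * (lam + mu - 1 - a - r) /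
    ((r + 1) * (2 * a + (d + r - 1))))

/-- The coefficient of `-g^(d+1) u` in the action of `g ∂` on an operator with symbol of weight
`a`, `d` orders below its leading term. The order of the operator is `δ - a`. -/
def symbolCoeff (lam mu a : ℂ) (d : ℕ) : ℂ :=
  binom (del lam mu - a) d * (lam + (del lam mu - a - d) / ((d : ℂ) + 1))

/-- The ratio between the coefficient of the transvectant `F_a → F_{a+d}` in the quantized action
and `(δ - a)_d B_{a+d,a}`. It depends on `a` and `d` only. The even factors of the denominators are
kept in the form `2 * a + e`, which is the form of the non-resonance conditions. -/
def cocycleNorm (a : ℂ) : ℕ → ℂ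
  | 2 => -1 / (12 * (2 * a + 1))
  | 3 => 2 / (9 * ((Real.sqrt 3 : ℝ) : ℂ) * (2 * a * (2 * a + 2) * (2 * a + 4)))
  | 4 => -5 / (36 * (2 * a * (2 * a + 1) * (2 * a + 3) * (2 * a + 5) * (2 * a + 6)))
  | _ => 0

/-- The function `B_{a+d,a}`, with the junk value `0` unless `2 ≤ d ≤ 4`. -/
def B (lam mu a : ℂ) : ℕ → ℂ
  | 2 => B₂ a lam mu
  | 3 => B₃ a lam mu
  | 4 => B₄ a lam mu
  | _ => 0

/-- The coefficient of the transvectant `F_a → F_{a+d}` in the quantized action. -/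
def cocycleCoeff (lam mu a : ℂ) (d : ℕ) : ℂ :=
  falling (del lam mu - a) d * B lam mu a d * cocycleNorm a d

theorem sqrt_three_sq : (((Real.sqrt 3 : ℝ) : ℂ)) ^ 2 = 3 := by
  rw [← Complex.ofReal_pow, Real.sq_sqrt (by norm_num)]; norm_num

theorem sqrt_three_ne_zero : (((Real.sqrt 3 : ℝ) : ℂ)) ≠ 0 := by
  intro h; have := sqrt_three_sq; rw [h] at this; norm_num at this

theorem gamSqrt_sq (lam mu : ℂ) : gamSqrt lam mu ^ 2 = gam lam mu := by
  rw [gamSqrt, gam, mul_pow, sqrt_three_sq]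

/-- Up to the constant `√3`, the function `B_{m+3,m}` is polynomial in `λ` and `μ` with rational
coefficients; the constant is absorbed by `cocycleNorm`. -/
theorem B₃_eq (m lam mu : ℂ) : B₃ m lam mu = ((Real.sqrt 3 : ℝ) : ℂ) *
    (3 * (lam + mu - 1) ^ 3 - 3 * (lam + mu - 1) * ((m + 1) * del lam mu + 1)) := by
  rw [B₃, gamSqrt]
  linear_combination (lam + mu - 1) ^ 3 * ((Real.sqrt 3 : ℝ) : ℂ) * sqrt_three_sq

theorem cocycleCoeff_three (lam mu a : ℂ) :
    cocycleCoeff lam mu a 3 = falling (del lam mu - a) 3 *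
      (3 * (lam + mu - 1) ^ 3 - 3 * (lam + mu - 1) * ((a + 1) * del lam mu + 1)) * (2 /
        (9 * (2 * a * (2 * a + 2) * (2 * a + 4)))) := by
  have h : (2 : ℂ) / (9 * ((Real.sqrt 3 : ℝ) : ℂ) * (2 * a * (2 * a + 2) * (2 * a + 4))) =
      (((Real.sqrt 3 : ℝ) : ℂ))⁻¹ * (2 / (9 * (2 * a * (2 * a + 2) * (2 * a + 4)))) := by
    simp only [div_eq_mul_inv, mul_inv]; ring
  simp only [cocycleCoeff, B, cocycleNorm, B₃_eq]
  rw [h]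
  have := sqrt_three_ne_zero
  generalize (2 / (9 * (2 * a * (2 * a + 2) * (2 * a + 4)))) = z
  field_simp

theorem cocycleCoeff_two (lam mu a : ℂ) : cocycleCoeff lam mu a 2 =
    falling (del lam mu - a) 2 * B₂ a lam mu * (-1 / (12 * (2 * a + 1))) := rfl

theorem cocycleCoeff_four (lam mu a : ℂ) : cocycleCoeff lam mu a 4 =
    falling (del lam mu - a) 4 * B₄ a lam mu *
      (-5 / (36 * (2 * a * (2 * a + 1) * (2 * a + 3) * (2 * a + 5) * (2 * a + 6)))) := rfl

/-- The coefficient of `g^(2) u` in the intertwining relation from weight `a` to weight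
`a + 1`. -/
theorem intertwining_coeff_one_two (lam mu a : ℂ) (h : ∀ e : ℕ, e ≤ 0 → 2 * a + e ≠ 0) :
    quantCoeff lam mu a 1 * a - symbolCoeff lam mu a 1 = 0 := by
  have h0 : a ≠ 0 := fun e => h 0 (by norm_num) (by rw [e]; simp)
  -- Dividing by `(δ - a)_1` leaves an identity in `a`, `δ` and `s = λ + μ - 1`.
  have key : ∀ s D : ℂ,
      ((s - a) / (2 * a)) * a - ((s + 1 - D) / 2 + (D - a - 1) / 2) = 0 := by
    intro s D
    field_simp
    ring
  obtain ⟨D, rfl⟩ : ∃ D, mu = lam + D := ⟨mu - lam, by ring⟩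
  have hk := key (lam + (lam + D) - 1) D
  clear key
  simp only [quantCoeff, symbolCoeff, binom, falling, Finset.prod_range_succ,
    Finset.prod_range_zero, del, Nat.factorial, add_sub_cancel_left]
  push_cast
  simp only [div_eq_mul_inv, mul_inv] at hk ⊢
  linear_combination (D - a) * hk

/-- The coefficient of `g^(2) u'` in the intertwining relation from weight `a` to weight
`a + 2`. -/
theorem intertwining_coeff_two_two (lam mu a : ℂ) (h : ∀ e : ℕ, e ≤ 2 → 2 * a + e ≠ 0) :
    quantCoeff lam mu a 2 * (1 + 2 * a) - quantCoeff lam mu (a + 1) 1 * symbolCoeff lam mu a 1 =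
      0 := by
  have h0 : a ≠ 0 := fun e => h 0 (by norm_num) (by rw [e]; simp)
  have h1 : a * 2 + 1 ≠ 0 := by simpa [mul_comm] using h 1 (by norm_num)
  have e2 : 2 * a + 2 = 2 * (a + 1) := by ring
  have h2 : a + 1 ≠ 0 := fun e => h 2 (by norm_num) (by push_cast; linear_combination 2 * e)
  -- Dividing by `(δ - a)_2` leaves an identity in `a`, `δ` and `s = λ + μ - 1`.
  have key : ∀ s D : ℂ,
      ((s - a) * (s - a - 1) / (2 * (2 * a + 1) * (2 * a + 2))) * (1 + 2 * a)
        - ((s - a - 1) / (2 * a + 2)) * ((s + 1 - D) / 2 + (D - a - 1) / 2) = 0 := by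
    intro s D
    simp only [e2]
    field_simp
    ring
  obtain ⟨D, rfl⟩ : ∃ D, mu = lam + D := ⟨mu - lam, by ring⟩
  have hk := key (lam + (lam + D) - 1) D
  clear key
  simp only [quantCoeff, symbolCoeff, binom, falling, Finset.prod_range_succ,
    Finset.prod_range_zero, del, Nat.factorial, add_sub_cancel_left]
  push_cast
  simp only [div_eq_mul_inv, mul_inv] at hk ⊢
  linear_combination ((D - a) * (D - a - 1)) * hk

/-- The coefficient of `g^(3) u` in the intertwining relation from weight `a` to weight
`a + 2`. -/
theorem intertwining_coeff_two_three (lam mu a : ℂ) (h : ∀ e : ℕ, e ≤ 2 → 2 * a + e ≠ 0) :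
    quantCoeff lam mu a 2 * a - quantCoeff lam mu (a + 1) 1 * symbolCoeff lam mu a 1
      - symbolCoeff lam mu a 2 =
      cocycleCoeff lam mu a 2 := by
  have h0 : a ≠ 0 := fun e => h 0 (by norm_num) (by rw [e]; simp)
  have h1 : a * 2 + 1 ≠ 0 := by simpa [mul_comm] using h 1 (by norm_num)
  have e2 : 2 * a + 2 = 2 * (a + 1) := by ring
  have h2 : a + 1 ≠ 0 := fun e => h 2 (by norm_num) (by push_cast; linear_combination 2 * e)
  -- Dividing by `(δ - a)_2` leaves an identity in `a`, `δ` and `s = λ + μ - 1`.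
  have key : ∀ s D : ℂ,
      ((s - a) * (s - a - 1) / (2 * (2 * a + 1) * (2 * a + 2))) * a
        - ((s - a - 1) / (2 * a + 2)) * ((s + 1 - D) / 2 + (D - a - 1) / 2)
        - (((s + 1 - D) / 2 + (D - a - 2) / 3) / 2) =
      (3 * s ^ 2 - ((2 * a + 1) * D + (a ^ 2 + a + 1))) * (-1 / (12 * (2 * a + 1))) := by
    intro s D
    simp only [e2]
    field_simp
    ring
  obtain ⟨D, rfl⟩ : ∃ D, mu = lam + D := ⟨mu - lam, by ring⟩
  have hk := key (lam + (lam + D) - 1) D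
  clear key
  simp only [cocycleCoeff_two, B₂, gam, quantCoeff, symbolCoeff, binom, falling,
    Finset.prod_range_succ, Finset.prod_range_zero, del, Nat.factorial, add_sub_cancel_left]
  push_cast
  simp only [div_eq_mul_inv, mul_inv] at hk ⊢
  linear_combination ((D - a) * (D - a - 1)) * hk

/-- The coefficient of `g^(2) u''` in the intertwining relation from weight `a` to weight
`a + 3`. -/
theorem intertwining_coeff_three_two (lam mu a : ℂ) (h : ∀ e : ℕ, e ≤ 4 → 2 * a + e ≠ 0) :
    quantCoeff lam mu a 3 * (3 + 3 * a) - quantCoeff lam mu (a + 1) 2 * symbolCoeff lam mu a 1 =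
      0 := by
  have h0 : a ≠ 0 := fun e => h 0 (by norm_num) (by rw [e]; simp)
  have h1 : a * 2 + 1 ≠ 0 := by simpa [mul_comm] using h 1 (by norm_num)
  have e2 : 2 * a + 2 = 2 * (a + 1) := by ring
  have h2 : a + 1 ≠ 0 := fun e => h 2 (by norm_num) (by push_cast; linear_combination 2 * e)
  have h3 : a * 2 + 3 ≠ 0 := by simpa [mul_comm] using h 3 (by norm_num)
  have e4 : 2 * a + 4 = 2 * (a + 2) := by ring
  have h4 : a + 2 ≠ 0 := fun e => h 4 (by norm_num) (by push_cast; linear_combination 2 * e)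
  -- Dividing by `(δ - a)_3` leaves an identity in `a`, `δ` and `s = λ + μ - 1`.
  have key : ∀ s D : ℂ,
      ((s - a) * (s - a - 1) * (s - a - 2) / (6 * (2 * a + 2) * (2 * a + 3) * (2 * a + 4)))
        * (3 + 3 * a) - ((s - a - 1) * (s - a - 2) / (2 * (2 * a + 3) * (2 * a + 4)))
        * ((s + 1 - D) / 2 + (D - a - 1) / 2) = 0 := by
    intro s D
    simp only [e2, e4]
    field_simp
    ring
  obtain ⟨D, rfl⟩ : ∃ D, mu = lam + D := ⟨mu - lam, by ring⟩
  have hk := key (lam + (lam + D) - 1) D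
  clear key
  simp only [quantCoeff, symbolCoeff, binom, falling, Finset.prod_range_succ,
    Finset.prod_range_zero, del, Nat.factorial, add_sub_cancel_left]
  push_cast
  simp only [div_eq_mul_inv, mul_inv] at hk ⊢
  linear_combination ((D - a) * (D - a - 1) * (D - a - 2)) * hk

/-- The coefficient of `g^(3) u'` in the intertwining relation from weight `a` to weight
`a + 3`. -/
theorem intertwining_coeff_three_three (lam mu a : ℂ) (h : ∀ e : ℕ, e ≤ 4 → 2 * a + e ≠ 0) :
    quantCoeff lam mu a 3 * (1 + 3 * a) - quantCoeff lam mu (a + 1) 2 * symbolCoeff lam mu a 1 * 2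
      - quantCoeff lam mu (a + 2) 1 * symbolCoeff lam mu a 2 =
      cocycleCoeff lam mu a 3
        + cocycleCoeff lam mu (a + 1) 2 * quantCoeff lam mu a 1 := by
  have h0 : a ≠ 0 := fun e => h 0 (by norm_num) (by rw [e]; simp)
  have h1 : a * 2 + 1 ≠ 0 := by simpa [mul_comm] using h 1 (by norm_num)
  have e2 : 2 * a + 2 = 2 * (a + 1) := by ring
  have h2 : a + 1 ≠ 0 := fun e => h 2 (by norm_num) (by push_cast; linear_combination 2 * e)
  have h3 : a * 2 + 3 ≠ 0 := by simpa [mul_comm] using h 3 (by norm_num)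
  have e4 : 2 * a + 4 = 2 * (a + 2) := by ring
  have h4 : a + 2 ≠ 0 := fun e => h 4 (by norm_num) (by push_cast; linear_combination 2 * e)
  -- Dividing by `(δ - a)_3` leaves an identity in `a`, `δ` and `s = λ + μ - 1`.
  have key : ∀ s D : ℂ,
      ((s - a) * (s - a - 1) * (s - a - 2) / (6 * (2 * a + 2) * (2 * a + 3) * (2 * a + 4)))
        * (1 + 3 * a) - ((s - a - 1) * (s - a - 2) / (2 * (2 * a + 3) * (2 * a + 4)))
        * ((s + 1 - D) / 2 + (D - a - 1) / 2) * 2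
        - ((s - a - 2) / (2 * a + 4)) * (((s + 1 - D) / 2 + (D - a - 2) / 3) / 2) =
      (3 * s ^ 3 - 3 * s * ((a + 1) * D + 1)) * (2 / (9 * (2 * a * (2 * a + 2) * (2 * a + 4))))
        + (3 * s ^ 2 - ((2 * (a + 1) + 1) * D + ((a + 1) ^ 2 + (a + 1) + 1)))
          * (-1 / (12 * (2 * a + 3))) * ((s - a) / (2 * a)) := by
    intro s D
    simp only [e2, e4]
    field_simp
    ring
  obtain ⟨D, rfl⟩ : ∃ D, mu = lam + D := ⟨mu - lam, by ring⟩
  have hk := key (lam + (lam + D) - 1) D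
  clear key
  simp only [cocycleCoeff_two, B₂, gam, cocycleCoeff_three, quantCoeff, symbolCoeff, binom,
    falling, Finset.prod_range_succ, Finset.prod_range_zero, del, Nat.factorial,
    add_sub_cancel_left]
  push_cast
  simp only [div_eq_mul_inv, mul_inv] at hk ⊢
  linear_combination ((D - a) * (D - a - 1) * (D - a - 2)) * hk

/-- The coefficient of `g^(4) u` in the intertwining relation from weight `a` to weight
`a + 3`. -/
theorem intertwining_coeff_three_four (lam mu a : ℂ) (h : ∀ e : ℕ, e ≤ 4 → 2 * a + e ≠ 0) :
    quantCoeff lam mu a 3 * a - quantCoeff lam mu (a + 1) 2 * symbolCoeff lam mu a 1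
      - quantCoeff lam mu (a + 2) 1 * symbolCoeff lam mu a 2 - symbolCoeff lam mu a 3 =
      cocycleCoeff lam mu a 3 * (-(a / 2)) := by
  have h0 : a ≠ 0 := fun e => h 0 (by norm_num) (by rw [e]; simp)
  have h1 : a * 2 + 1 ≠ 0 := by simpa [mul_comm] using h 1 (by norm_num)
  have e2 : 2 * a + 2 = 2 * (a + 1) := by ring
  have h2 : a + 1 ≠ 0 := fun e => h 2 (by norm_num) (by push_cast; linear_combination 2 * e)
  have h3 : a * 2 + 3 ≠ 0 := by simpa [mul_comm] using h 3 (by norm_num)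
  have e4 : 2 * a + 4 = 2 * (a + 2) := by ring
  have h4 : a + 2 ≠ 0 := fun e => h 4 (by norm_num) (by push_cast; linear_combination 2 * e)
  -- Dividing by `(δ - a)_3` leaves an identity in `a`, `δ` and `s = λ + μ - 1`.
  have key : ∀ s D : ℂ,
      ((s - a) * (s - a - 1) * (s - a - 2) / (6 * (2 * a + 2) * (2 * a + 3) * (2 * a + 4))) * a
        - ((s - a - 1) * (s - a - 2) / (2 * (2 * a + 3) * (2 * a + 4)))
        * ((s + 1 - D) / 2 + (D - a - 1) / 2) - ((s - a - 2) / (2 * a + 4))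
        * (((s + 1 - D) / 2 + (D - a - 2) / 3) / 2) - (((s + 1 - D) / 2 + (D - a - 3) / 4) / 6) =
      (3 * s ^ 3 - 3 * s * ((a + 1) * D + 1)) * (2 / (9 * (2 * a * (2 * a + 2) * (2 * a + 4))))
        * (-(a / 2)) := by
    intro s D
    simp only [e2, e4]
    field_simp
    ring
  obtain ⟨D, rfl⟩ : ∃ D, mu = lam + D := ⟨mu - lam, by ring⟩
  have hk := key (lam + (lam + D) - 1) D
  clear key
  simp only [cocycleCoeff_three, quantCoeff, symbolCoeff, binom, falling, Finset.prod_range_succ,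
    Finset.prod_range_zero, del, Nat.factorial, add_sub_cancel_left]
  push_cast
  simp only [div_eq_mul_inv, mul_inv] at hk ⊢
  linear_combination ((D - a) * (D - a - 1) * (D - a - 2)) * hk

/-- The coefficient of `g^(2) u'''` in the intertwining relation from weight `a` to weight
`a + 4`. -/
theorem intertwining_coeff_four_two (lam mu a : ℂ) (h : ∀ e : ℕ, e ≤ 6 → 2 * a + e ≠ 0) :
    quantCoeff lam mu a 4 * (6 + 4 * a) - quantCoeff lam mu (a + 1) 3 * symbolCoeff lam mu a 1 =
      0 := by
  have h0 : a ≠ 0 := fun e => h 0 (by norm_num) (by rw [e]; simp)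
  have h1 : a * 2 + 1 ≠ 0 := by simpa [mul_comm] using h 1 (by norm_num)
  have e2 : 2 * a + 2 = 2 * (a + 1) := by ring
  have h2 : a + 1 ≠ 0 := fun e => h 2 (by norm_num) (by push_cast; linear_combination 2 * e)
  have h3 : a * 2 + 3 ≠ 0 := by simpa [mul_comm] using h 3 (by norm_num)
  have e4 : 2 * a + 4 = 2 * (a + 2) := by ring
  have h4 : a + 2 ≠ 0 := fun e => h 4 (by norm_num) (by push_cast; linear_combination 2 * e)
  have h5 : a * 2 + 5 ≠ 0 := by simpa [mul_comm] using h 5 (by norm_num)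
  have e6 : 2 * a + 6 = 2 * (a + 3) := by ring
  have h6 : a + 3 ≠ 0 := fun e => h 6 (by norm_num) (by push_cast; linear_combination 2 * e)
  -- Dividing by `(δ - a)_4` leaves an identity in `a`, `δ` and `s = λ + μ - 1`.
  have key : ∀ s D : ℂ,
      ((s - a) * (s - a - 1) * (s - a - 2) * (s - a - 3)
        / (24 * (2 * a + 3) * (2 * a + 4) * (2 * a + 5) * (2 * a + 6))) * (6 + 4 * a)
        - ((s - a - 1) * (s - a - 2) * (s - a - 3) / (6 * (2 * a + 4) * (2 * a + 5) * (2 * a + 6)))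
        * ((s + 1 - D) / 2 + (D - a - 1) / 2) = 0 := by
    intro s D
    simp only [e4, e6]
    field_simp
    ring
  obtain ⟨D, rfl⟩ : ∃ D, mu = lam + D := ⟨mu - lam, by ring⟩
  have hk := key (lam + (lam + D) - 1) D
  clear key
  simp only [quantCoeff, symbolCoeff, binom, falling, Finset.prod_range_succ,
    Finset.prod_range_zero, del, Nat.factorial, add_sub_cancel_left]
  push_cast
  simp only [div_eq_mul_inv, mul_inv] at hk ⊢
  linear_combination ((D - a) * (D - a - 1) * (D - a - 2) * (D - a - 3)) * hk

/-- The coefficient of `g^(3) u''` in the intertwining relation from weight `a` to weight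
`a + 4`. -/
theorem intertwining_coeff_four_three (lam mu a : ℂ) (h : ∀ e : ℕ, e ≤ 6 → 2 * a + e ≠ 0) :
    quantCoeff lam mu a 4 * (4 + 6 * a) - quantCoeff lam mu (a + 1) 3 * symbolCoeff lam mu a 1 * 3
      - quantCoeff lam mu (a + 2) 2 * symbolCoeff lam mu a 2 =
      cocycleCoeff lam mu a 4
        + cocycleCoeff lam mu (a + 1) 3 * quantCoeff lam mu a 1
        + cocycleCoeff lam mu (a + 2) 2 * quantCoeff lam mu a 2 := by
  have h0 : a ≠ 0 := fun e => h 0 (by norm_num) (by rw [e]; simp)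
  have h1 : a * 2 + 1 ≠ 0 := by simpa [mul_comm] using h 1 (by norm_num)
  have e2 : 2 * a + 2 = 2 * (a + 1) := by ring
  have h2 : a + 1 ≠ 0 := fun e => h 2 (by norm_num) (by push_cast; linear_combination 2 * e)
  have h3 : a * 2 + 3 ≠ 0 := by simpa [mul_comm] using h 3 (by norm_num)
  have e4 : 2 * a + 4 = 2 * (a + 2) := by ring
  have h4 : a + 2 ≠ 0 := fun e => h 4 (by norm_num) (by push_cast; linear_combination 2 * e)
  have h5 : a * 2 + 5 ≠ 0 := by simpa [mul_comm] using h 5 (by norm_num)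
  have e6 : 2 * a + 6 = 2 * (a + 3) := by ring
  have h6 : a + 3 ≠ 0 := fun e => h 6 (by norm_num) (by push_cast; linear_combination 2 * e)
  -- Dividing by `(δ - a)_4` leaves an identity in `a`, `δ` and `s = λ + μ - 1`.
  have key : ∀ s D : ℂ,
      ((s - a) * (s - a - 1) * (s - a - 2) * (s - a - 3)
        / (24 * (2 * a + 3) * (2 * a + 4) * (2 * a + 5) * (2 * a + 6))) * (4 + 6 * a)
        - ((s - a - 1) * (s - a - 2) * (s - a - 3) / (6 * (2 * a + 4) * (2 * a + 5) * (2 * a + 6)))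
        * ((s + 1 - D) / 2 + (D - a - 1) / 2) * 3
        - ((s - a - 2) * (s - a - 3) / (2 * (2 * a + 5) * (2 * a + 6)))
        * (((s + 1 - D) / 2 + (D - a - 2) / 3) / 2) =
      ((3 * s ^ 2) ^ 2 - 3 * s ^ 2 * (2 * (2 * a + 3) * D - (2 * a ^ 2 + 6 * a - 3))
        - 3 / 5 * a * (a + 3) * (2 * (2 * a + 3) * D + (a ^ 2 + 3 * a + 6)))
        * (-5 / (36 * ((2 * a) * (2 * a + 1) * (2 * a + 3) * (2 * a + 5) * (2 * a + 6))))
        + (3 * s ^ 3 - 3 * s * (((a + 1) + 1) * D + 1))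
          * (2 / (9 * (2 * (a + 1) * (2 * (a + 1) + 2) * (2 * (a + 1) + 4)))) * ((s - a) / (2 * a))
        + (3 * s ^ 2 - ((2 * (a + 2) + 1) * D + ((a + 2) ^ 2 + (a + 2) + 1)))
          * (-1 / (12 * (2 * a + 5))) * ((s - a) * (s - a - 1)
          / (2 * (2 * a + 1) * (2 * a + 2))) := by
    intro s D
    simp only [e2, e4, e6]
    rw [show 2 * (a + 1) + 2 = 2 * (a + 2) by ring, show 2 * (a + 1) + 4 = 2 * (a + 3) by ring]
    field_simp
    ring
  obtain ⟨D, rfl⟩ : ∃ D, mu = lam + D := ⟨mu - lam, by ring⟩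
  have hk := key (lam + (lam + D) - 1) D
  clear key
  simp only [cocycleCoeff_two, B₂, gam, cocycleCoeff_three, cocycleCoeff_four, B₄, quantCoeff,
    symbolCoeff, binom, falling, Finset.prod_range_succ, Finset.prod_range_zero, del,
    Nat.factorial, add_sub_cancel_left]
  push_cast
  simp only [div_eq_mul_inv, mul_inv] at hk ⊢
  linear_combination ((D - a) * (D - a - 1) * (D - a - 2) * (D - a - 3)) * hk

/-- The coefficient of `g^(4) u'` in the intertwining relation from weight `a` to weight
`a + 4`. -/
theorem intertwining_coeff_four_four (lam mu a : ℂ) (h : ∀ e : ℕ, e ≤ 6 → 2 * a + e ≠ 0) :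
    quantCoeff lam mu a 4 * (1 + 4 * a) - quantCoeff lam mu (a + 1) 3 * symbolCoeff lam mu a 1 * 3
      - quantCoeff lam mu (a + 2) 2 * symbolCoeff lam mu a 2 * 2
      - quantCoeff lam mu (a + 3) 1 * symbolCoeff lam mu a 3 =
      cocycleCoeff lam mu a 4 * (-((2 * a + 1) / 2))
        + cocycleCoeff lam mu (a + 1) 3 * (-((a + 1) / 2)) * quantCoeff lam mu a 1 := by
  have h0 : a ≠ 0 := fun e => h 0 (by norm_num) (by rw [e]; simp)
  have h1 : a * 2 + 1 ≠ 0 := by simpa [mul_comm] using h 1 (by norm_num)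
  have e2 : 2 * a + 2 = 2 * (a + 1) := by ring
  have h2 : a + 1 ≠ 0 := fun e => h 2 (by norm_num) (by push_cast; linear_combination 2 * e)
  have h3 : a * 2 + 3 ≠ 0 := by simpa [mul_comm] using h 3 (by norm_num)
  have e4 : 2 * a + 4 = 2 * (a + 2) := by ring
  have h4 : a + 2 ≠ 0 := fun e => h 4 (by norm_num) (by push_cast; linear_combination 2 * e)
  have h5 : a * 2 + 5 ≠ 0 := by simpa [mul_comm] using h 5 (by norm_num)
  have e6 : 2 * a + 6 = 2 * (a + 3) := by ring
  have h6 : a + 3 ≠ 0 := fun e => h 6 (by norm_num) (by push_cast; linear_combination 2 * e)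
  -- Dividing by `(δ - a)_4` leaves an identity in `a`, `δ` and `s = λ + μ - 1`.
  have key : ∀ s D : ℂ,
      ((s - a) * (s - a - 1) * (s - a - 2) * (s - a - 3)
        / (24 * (2 * a + 3) * (2 * a + 4) * (2 * a + 5) * (2 * a + 6))) * (1 + 4 * a)
        - ((s - a - 1) * (s - a - 2) * (s - a - 3) / (6 * (2 * a + 4) * (2 * a + 5) * (2 * a + 6)))
        * ((s + 1 - D) / 2 + (D - a - 1) / 2) * 3
        - ((s - a - 2) * (s - a - 3) / (2 * (2 * a + 5) * (2 * a + 6)))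
        * (((s + 1 - D) / 2 + (D - a - 2) / 3) / 2) * 2
        - ((s - a - 3) / (2 * a + 6)) * (((s + 1 - D) / 2 + (D - a - 3) / 4) / 6) =
      ((3 * s ^ 2) ^ 2 - 3 * s ^ 2 * (2 * (2 * a + 3) * D - (2 * a ^ 2 + 6 * a - 3))
        - 3 / 5 * a * (a + 3) * (2 * (2 * a + 3) * D + (a ^ 2 + 3 * a + 6)))
        * (-5 / (36 * ((2 * a) * (2 * a + 1) * (2 * a + 3) * (2 * a + 5) * (2 * a + 6))))
        * (-((2 * a + 1) / 2))
        + (3 * s ^ 3 - 3 * s * (((a + 1) + 1) * D + 1))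
          * (2 / (9 * (2 * (a + 1) * (2 * (a + 1) + 2) * (2 * (a + 1) + 4)))) * (-((a + 1) / 2))
          * ((s - a) / (2 * a)) := by
    intro s D
    simp only [e4, e6]
    rw [show 2 * (a + 1) + 2 = 2 * (a + 2) by ring, show 2 * (a + 1) + 4 = 2 * (a + 3) by ring]
    field_simp
    ring
  obtain ⟨D, rfl⟩ : ∃ D, mu = lam + D := ⟨mu - lam, by ring⟩
  have hk := key (lam + (lam + D) - 1) D
  clear key
  simp only [cocycleCoeff_three, cocycleCoeff_four, B₄, gam, quantCoeff, symbolCoeff, binom,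
    falling, Finset.prod_range_succ, Finset.prod_range_zero, del, Nat.factorial,
    add_sub_cancel_left]
  push_cast
  simp only [div_eq_mul_inv, mul_inv] at hk ⊢
  linear_combination ((D - a) * (D - a - 1) * (D - a - 2) * (D - a - 3)) * hk

/-- The coefficient of `g^(5) u` in the intertwining relation from weight `a` to weight
`a + 4`. -/
theorem intertwining_coeff_four_five (lam mu a : ℂ) (h : ∀ e : ℕ, e ≤ 6 → 2 * a + e ≠ 0) :
    quantCoeff lam mu a 4 * a - quantCoeff lam mu (a + 1) 3 * symbolCoeff lam mu a 1
      - quantCoeff lam mu (a + 2) 2 * symbolCoeff lam mu a 2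
      - quantCoeff lam mu (a + 3) 1 * symbolCoeff lam mu a 3 - symbolCoeff lam mu a 4 =
      cocycleCoeff lam mu a 4 * (a * (2 * a + 1) / 10) := by
  have h0 : a ≠ 0 := fun e => h 0 (by norm_num) (by rw [e]; simp)
  have h1 : a * 2 + 1 ≠ 0 := by simpa [mul_comm] using h 1 (by norm_num)
  have e2 : 2 * a + 2 = 2 * (a + 1) := by ring
  have h2 : a + 1 ≠ 0 := fun e => h 2 (by norm_num) (by push_cast; linear_combination 2 * e)
  have h3 : a * 2 + 3 ≠ 0 := by simpa [mul_comm] using h 3 (by norm_num)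
  have e4 : 2 * a + 4 = 2 * (a + 2) := by ring
  have h4 : a + 2 ≠ 0 := fun e => h 4 (by norm_num) (by push_cast; linear_combination 2 * e)
  have h5 : a * 2 + 5 ≠ 0 := by simpa [mul_comm] using h 5 (by norm_num)
  have e6 : 2 * a + 6 = 2 * (a + 3) := by ring
  have h6 : a + 3 ≠ 0 := fun e => h 6 (by norm_num) (by push_cast; linear_combination 2 * e)
  -- Dividing by `(δ - a)_4` leaves an identity in `a`, `δ` and `s = λ + μ - 1`.
  have key : ∀ s D : ℂ,
      ((s - a) * (s - a - 1) * (s - a - 2) * (s - a - 3)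
        / (24 * (2 * a + 3) * (2 * a + 4) * (2 * a + 5) * (2 * a + 6))) * a
        - ((s - a - 1) * (s - a - 2) * (s - a - 3) / (6 * (2 * a + 4) * (2 * a + 5) * (2 * a + 6)))
        * ((s + 1 - D) / 2 + (D - a - 1) / 2) - ((s - a - 2) * (s - a - 3)
        / (2 * (2 * a + 5) * (2 * a + 6))) * (((s + 1 - D) / 2 + (D - a - 2) / 3) / 2)
        - ((s - a - 3) / (2 * a + 6)) * (((s + 1 - D) / 2 + (D - a - 3) / 4) / 6)
        - (((s + 1 - D) / 2 + (D - a - 4) / 5) / 24) =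
      ((3 * s ^ 2) ^ 2 - 3 * s ^ 2 * (2 * (2 * a + 3) * D - (2 * a ^ 2 + 6 * a - 3))
        - 3 / 5 * a * (a + 3) * (2 * (2 * a + 3) * D + (a ^ 2 + 3 * a + 6)))
        * (-5 / (36 * ((2 * a) * (2 * a + 1) * (2 * a + 3) * (2 * a + 5) * (2 * a + 6))))
        * (a * (2 * a + 1) / 10) := by
    intro s D
    simp only [e4, e6]
    field_simp
    ring
  obtain ⟨D, rfl⟩ : ∃ D, mu = lam + D := ⟨mu - lam, by ring⟩
  have hk := key (lam + (lam + D) - 1) D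
  clear key
  simp only [cocycleCoeff_four, B₄, gam, quantCoeff, symbolCoeff, binom, falling,
    Finset.prod_range_succ, Finset.prod_range_zero, del, Nat.factorial, add_sub_cancel_left]
  push_cast
  simp only [div_eq_mul_inv, mul_inv] at hk ⊢
  linear_combination ((D - a) * (D - a - 1) * (D - a - 2) * (D - a - 3)) * hk

/-! ### The intertwining relations for densities -/

/-- The transvectant `F_2 ⊗ F_a → F_{a+d}` of order `d - 2`, normalized so that `h u^(d-2)` has
coefficient `1`, for `2 ≤ d ≤ 4`; the junk value is `0`. Evaluated at `h = g^(3)`, it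
vanishes when `g ∂` lies in the projective subalgebra. -/
def transvectant (d : ℕ) (a : ℂ) (h u : ℂ[X]) : ℂ[X] :=
  match d with
  | 2 => h * u
  | 3 => h * derivative u - (a / 2) • (derivative h * u)
  | 4 => h * derivative^[2] u - ((2 * a + 1) / 2) • (derivative h * derivative u)
      + (a * (2 * a + 1) / 10) • (derivative^[2] h * u)
  | _ => 0

/-- The action of `g ∂` on the density module `F_a`. -/
def lieDensity (a : ℂ) (g u : ℂ[X]) : ℂ[X] := g * derivative u + a • (derivative g * u)

/-- The component of `L_{λ,μ}(g ∂)` that lowers the order of an operator by `d`, applied to the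
coefficient `u` of weight `a`. -/
def symbolTerm (lam mu a : ℂ) (g : ℂ[X]) : ℕ → ℂ[X] → ℂ[X]
  | 0, u => lieDensity a g u
  | d + 1, u => -(symbolCoeff lam mu a (d + 1) • (u * derivative^[d + 2] g))

/-- The component `F_a → F_{a+d}` of the quantized action of `g ∂`. -/
def modelTerm (lam mu a : ℂ) (g : ℂ[X]) : ℕ → ℂ[X] → ℂ[X]
  | 0, u => lieDensity a g u
  | d + 1, u => cocycleCoeff lam mu a (d + 1) • transvectant (d + 1) a (derivative^[3] g) u

theorem column_zero (lam mu a : ℂ) (g u : ℂ[X]) :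
    quantCoeff lam mu a 0 • symbolTerm lam mu a g 0 u =
      modelTerm lam mu a g 0 (quantCoeff lam mu a 0 • u) := by
  simp [quantCoeff, symbolTerm, modelTerm]

theorem quantCoeff_zero (lam mu a : ℂ) : quantCoeff lam mu a 0 = 1 := by
  simp [quantCoeff]

theorem column_one (lam mu a : ℂ) (h : ∀ e : ℕ, e ≤ 0 → 2 * a + e ≠ 0) (g u : ℂ[X]) :
    quantCoeff lam mu a 1 • derivative (symbolTerm lam mu a g 0 u) + symbolTerm lam mu a g 1 u =
      modelTerm lam mu a g 1 u
        + modelTerm lam mu (a + 1) g 0 (quantCoeff lam mu a 1 • derivative u) := by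
  have E2 := congrArg (C : ℂ → ℂ[X]) (intertwining_coeff_one_two lam mu a h)
  simp only [symbolTerm, modelTerm, transvectant, lieDensity, smul_eq_C_mul, derivative_add,
    derivative_mul, derivative_C, Function.iterate_succ_apply',
    Function.iterate_zero_apply] at *
  simp only [map_add, map_sub, map_mul, map_one, map_zero] at *
  linear_combination (derivative (derivative g) * u) * E2

theorem column_two (lam mu a : ℂ) (h : ∀ e : ℕ, e ≤ 2 → 2 * a + e ≠ 0) (g u : ℂ[X]) :
    quantCoeff lam mu a 2 • derivative^[2] (symbolTerm lam mu a g 0 u)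
        + quantCoeff lam mu (a + 1) 1 • derivative (symbolTerm lam mu a g 1 u)
        + symbolTerm lam mu a g 2 u =
      modelTerm lam mu a g 2 u
        + modelTerm lam mu (a + 1) g 1 (quantCoeff lam mu a 1 • derivative u)
        + modelTerm lam mu (a + 2) g 0 (quantCoeff lam mu a 2 • derivative^[2] u) := by
  have E2 := congrArg (C : ℂ → ℂ[X]) (intertwining_coeff_two_two lam mu a h)
  have E3 := congrArg (C : ℂ → ℂ[X]) (intertwining_coeff_two_three lam mu a h)
  simp only [symbolTerm, modelTerm, transvectant, lieDensity, smul_eq_C_mul, derivative_add,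
    derivative_neg, derivative_mul, derivative_C, Function.iterate_succ_apply',
    Function.iterate_zero_apply] at *
  simp only [map_add, map_sub, map_mul, map_one, map_zero, map_ofNat] at *
  linear_combination (derivative (derivative g) * derivative u) * E2 +
    (derivative (derivative (derivative g)) * u) * E3

theorem column_three (lam mu a : ℂ) (h : ∀ e : ℕ, e ≤ 4 → 2 * a + e ≠ 0) (g u : ℂ[X]) :
    quantCoeff lam mu a 3 • derivative^[3] (symbolTerm lam mu a g 0 u)
        + quantCoeff lam mu (a + 1) 2 • derivative^[2] (symbolTerm lam mu a g 1 u)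
        + quantCoeff lam mu (a + 2) 1 • derivative (symbolTerm lam mu a g 2 u)
        + symbolTerm lam mu a g 3 u =
      modelTerm lam mu a g 3 u
        + modelTerm lam mu (a + 1) g 2 (quantCoeff lam mu a 1 • derivative u)
        + modelTerm lam mu (a + 2) g 1 (quantCoeff lam mu a 2 • derivative^[2] u)
        + modelTerm lam mu (a + 3) g 0 (quantCoeff lam mu a 3 • derivative^[3] u) := by
  have E2 := congrArg (C : ℂ → ℂ[X]) (intertwining_coeff_three_two lam mu a h)
  have E3 := congrArg (C : ℂ → ℂ[X]) (intertwining_coeff_three_three lam mu a h)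
  have E4 := congrArg (C : ℂ → ℂ[X]) (intertwining_coeff_three_four lam mu a h)
  simp only [symbolTerm, modelTerm, transvectant, lieDensity, smul_eq_C_mul, derivative_add,
    derivative_neg, derivative_mul, derivative_C, Function.iterate_succ_apply',
    Function.iterate_zero_apply] at *
  simp only [map_add, map_sub, map_mul, map_neg, map_one, map_zero, map_ofNat] at *
  linear_combination (derivative (derivative g) * derivative (derivative u)) * E2 +
    (derivative (derivative (derivative g)) * derivative u) * E3 +
    (derivative (derivative (derivative (derivative g))) * u) * E4

/-- The intertwining relation from weight `a` to weight `a + 4`. After Leibniz's rule the terms with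
`g` and `g'` match identically, and the remaining ones are the four relations
`intertwining_coeff_four_*`. -/
theorem column_four (lam mu a : ℂ) (h : ∀ e : ℕ, e ≤ 6 → 2 * a + e ≠ 0) (g u : ℂ[X]) :
    quantCoeff lam mu a 4 • derivative^[4] (symbolTerm lam mu a g 0 u)
        + quantCoeff lam mu (a + 1) 3 • derivative^[3] (symbolTerm lam mu a g 1 u)
        + quantCoeff lam mu (a + 2) 2 • derivative^[2] (symbolTerm lam mu a g 2 u)
        + quantCoeff lam mu (a + 3) 1 • derivative (symbolTerm lam mu a g 3 u)
        + symbolTerm lam mu a g 4 u =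
      modelTerm lam mu a g 4 u
        + modelTerm lam mu (a + 1) g 3 (quantCoeff lam mu a 1 • derivative u)
        + modelTerm lam mu (a + 2) g 2 (quantCoeff lam mu a 2 • derivative^[2] u)
        + modelTerm lam mu (a + 3) g 1 (quantCoeff lam mu a 3 • derivative^[3] u)
        + modelTerm lam mu (a + 4) g 0 (quantCoeff lam mu a 4 • derivative^[4] u) := by
  have E2 := congrArg (C : ℂ → ℂ[X]) (intertwining_coeff_four_two lam mu a h)
  have E3 := congrArg (C : ℂ → ℂ[X]) (intertwining_coeff_four_three lam mu a h)
  have E4 := congrArg (C : ℂ → ℂ[X]) (intertwining_coeff_four_four lam mu a h)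
  have E5 := congrArg (C : ℂ → ℂ[X]) (intertwining_coeff_four_five lam mu a h)
  simp only [symbolTerm, modelTerm, transvectant, lieDensity, smul_eq_C_mul, derivative_add,
    derivative_neg, derivative_mul, derivative_C, Function.iterate_succ_apply',
    Function.iterate_zero_apply] at *
  simp only [map_add, map_sub, map_mul, map_neg, map_one, map_zero, map_ofNat] at *
  linear_combination (derivative (derivative g) * derivative (derivative (derivative u))) * E2 +
    (derivative (derivative (derivative g)) * derivative (derivative u)) * E3 +
    (derivative (derivative (derivative (derivative g))) * derivative u) * E4 +
    (derivative (derivative (derivative (derivative (derivative g)))) * u) * E5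

/-! ### The model of the subquotient -/

/-- The projective quantization: the unitriangular map sending an operator to its components in the
density modules `F_n, F_{n+1}, …`. -/
def quantize (n lam mu : ℂ) : Psi →ₗ[ℂ] Psi :=
  LinearMap.pi fun i => ∑ j ∈ Finset.range (i + 1),
    quantCoeff lam mu (n + j) (i - j) • (derivative ^ (i - j)) ∘ₗ LinearMap.proj j

theorem quantize_apply (n lam mu : ℂ) (u : Psi) (i : ℕ) :
    quantize n lam mu u i = ∑ j ∈ Finset.range (i + 1),
      quantCoeff lam mu (n + j) (i - j) • derivative^[i - j] (u j) := by
  simp [quantize, Module.End.pow_apply]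

/-- `quantize` with its diagonal term split off, showing that it is unitriangular. -/
theorem quantize_apply' (n lam mu : ℂ) (u : Psi) (i : ℕ) :
    quantize n lam mu u i = (∑ j ∈ Finset.range i,
      quantCoeff lam mu (n + j) (i - j) • derivative^[i - j] (u j)) + u i := by
  rw [quantize_apply, Finset.sum_range_succ]
  simp [quantCoeff_zero]

/-- The underlying space `F_n ⊕ ⋯ ⊕ F_{n+4}` of the model of `SQ^{δ-n,5}`. -/
abbrev Model : Type := Fin 5 → ℂ[X]

/-- The action of a vector field on the model with structure constants `b i j`. Natural subtraction
makes the terms with `j ≥ i` transvectants with index `0`, which are zero. -/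
def modelAction (n : ℂ) (b : Fin 5 → Fin 5 → ℂ) (V : Vec) (w : Model) : Model := fun i =>
  lieDensity (n + (i : ℕ)) V.coeff (w i) +
    ∑ j : Fin 5, b i j • transvectant (i - j) (n + (j : ℕ)) (derivative^[3] V.coeff) (w j)

/-- The structure constants of the model of `SQ^{δ-n,5}_{λ,μ}`. -/
def modelCoeff (n lam mu : ℂ) (i j : Fin 5) : ℂ := cocycleCoeff lam mu (n + (j : ℕ)) (i - j)

/-- The first five components of the projective quantization. -/
def quantMap (n lam mu : ℂ) : Psi →ₗ[ℂ] Model :=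
  LinearMap.pi fun i : Fin 5 => LinearMap.proj (i : ℕ) ∘ₗ quantize n lam mu

theorem quantMap_apply (n lam mu : ℂ) (u : Psi) (i : Fin 5) :
    quantMap n lam mu u i = quantize n lam mu u i := rfl

theorem ker_quantMap (n lam mu : ℂ) : LinearMap.ker (quantMap n lam mu) = lowerOrder 5 := by
  ext u
  rw [LinearMap.mem_ker]
  constructor
  · intro h i
    induction i using Nat.strong_induction_on with
    | _ i ih =>
      intro hi
      have h1 : quantize n lam mu u i = 0 := congrFun h ⟨i, hi⟩
      rw [quantize_apply', Finset.sum_eq_zero, zero_add] at h1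
      · exact h1
      · intro j hj
        have hj := Finset.mem_range.1 hj
        rw [ih j hj (hj.trans hi), iterate_derivative_zero, smul_zero]
  · intro h
    funext i
    rw [quantMap_apply, quantize_apply]
    refine Finset.sum_eq_zero fun j hj => ?_
    have hj := Finset.mem_range.1 hj
    rw [h j (by omega), iterate_derivative_zero, smul_zero]

theorem quantize_surjective_upto (n lam mu : ℂ) (w : Psi) (m : ℕ) :
    ∃ u : Psi, ∀ i < m, quantize n lam mu u i = w i := by
  induction m with
  | zero => exact ⟨0, by simp⟩
  | succ m ih =>
    obtain ⟨u, hu⟩ := ih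
    have key : ∀ i ≤ m, ∀ v, ∑ j ∈ Finset.range i, quantCoeff lam mu (n + j) (i - j) •
        derivative^[i - j] (Function.update u m v j) = ∑ j ∈ Finset.range i,
          quantCoeff lam mu (n + j) (i - j) • derivative^[i - j] (u j) := by
      intro i hi v
      refine Finset.sum_congr rfl fun j hj => ?_
      have hj := Finset.mem_range.1 hj
      rw [Function.update_of_ne (by omega)]
    refine ⟨Function.update u m (w m - ∑ j ∈ Finset.range m, quantCoeff lam mu (n + j) (m - j) •
        derivative^[m - j] (u j)), fun i hi => ?_⟩
    rw [quantize_apply', key i (by omega)]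
    rcases (Nat.lt_succ_iff.1 hi).lt_or_eq with h | rfl
    · rw [Function.update_of_ne h.ne, ← quantize_apply', hu i h]
    · rw [Function.update_self]; ring

theorem quantMap_surjective (n lam mu : ℂ) : Function.Surjective (quantMap n lam mu) := by
  intro w
  obtain ⟨u, hu⟩ := quantize_surjective_upto n lam mu
    (fun i => if h : i < 5 then w ⟨i, h⟩ else 0) 5
  refine ⟨u, funext fun i => ?_⟩
  rw [quantMap_apply, hu i i.2, dif_pos i.2]

theorem psiAction_apply (n lam mu : ℂ) (V : Vec) (u : Psi) (i : ℕ) :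
    psiAction (del lam mu - n) lam mu V u i = ∑ j ∈ Finset.range (i + 1),
      symbolTerm lam mu (n + j) V.coeff (i - j) (u j) := by
  rw [← Finset.sum_range_reflect, Finset.sum_range_succ', add_comm]
  simp only [psiAction, LinearMap.coe_mk, AddHom.coe_mk]
  rw [sub_eq_add_neg]
  congr 1
  · simp only [add_tsub_cancel_right, tsub_zero, tsub_self, symbolTerm, lieDensity]
    congr 2; ring
  · rw [← Finset.sum_neg_distrib, Finset.range_eq_Ico, Finset.sum_Ico_add'
      (fun s => symbolTerm lam mu (n + ((i + 1 - 1 - s : ℕ) : ℂ)) V.coeff (i - (i + 1 - 1 - s))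
        (u (i + 1 - 1 - s))) 0 i 1]
    refine Finset.sum_congr (by ext; simp) fun s hs => ?_
    obtain ⟨h1, h2⟩ := Finset.mem_Icc.1 hs
    obtain ⟨s, rfl⟩ := Nat.exists_eq_add_of_le' h1
    rw [show i - (i + 1 - 1 - (s + 1)) = s + 1 by omega, symbolTerm, symbolCoeff,
      show i + 1 - 1 - (s + 1) = i - (s + 1) by omega, Nat.cast_sub h2]
    congr 4
    · ring
    · push_cast; ring

/-- The uniform shape of the intertwining relation from weight `a` to weight `a + d`, `d ≤ 4`. -/
theorem column (lam mu a : ℂ) (d : ℕ) (hd : d ≤ 4)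
    (h : ∀ e : ℕ, e + 2 ≤ 2 * d → 2 * a + e ≠ 0) (g u : ℂ[X]) :
    ∑ r ∈ Finset.range (d + 1), quantCoeff lam mu (a + r) (d - r) •
        derivative^[d - r] (symbolTerm lam mu a g r u) =
      ∑ r ∈ Finset.range (d + 1),
        modelTerm lam mu (a + r) g (d - r) (quantCoeff lam mu a r • derivative^[r] u) := by
  interval_cases d
  · simpa using column_zero lam mu a g u
  all_goals
    simp only [Finset.sum_range_succ, Finset.sum_range_zero, zero_add, Nat.cast_zero, add_zero,
      Nat.cast_one, Nat.cast_ofNat, Nat.reduceAdd, Nat.reduceSub, tsub_zero, quantCoeff_zero,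
      one_smul, Function.iterate_zero, Function.iterate_one, id_eq, Nat.sub_self]
  · exact column_one lam mu a (fun e he => h e (by omega)) g u
  · exact column_two lam mu a (fun e he => h e (by omega)) g u
  · exact column_three lam mu a (fun e he => h e (by omega)) g u
  · exact column_four lam mu a (fun e he => h e (by omega)) g u

theorem transvectant_add (d : ℕ) (a : ℂ) (h u v : ℂ[X]) :
    transvectant d a h (u + v) = transvectant d a h u + transvectant d a h v := by
  unfold transvectant
  split <;> simp only [derivative_add, Function.iterate_succ_apply', Function.iterate_zero_apply,
    smul_eq_C_mul, mul_add, add_zero]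
  all_goals ring

theorem transvectant_smul (d : ℕ) (a c : ℂ) (h u : ℂ[X]) :
    transvectant d a h (c • u) = c • transvectant d a h u := by
  unfold transvectant
  split <;> simp only [derivative_C_mul, Function.iterate_succ_apply',
    Function.iterate_zero_apply, smul_eq_C_mul, mul_zero]
  all_goals ring

theorem lieDensity_add (a : ℂ) (g u v : ℂ[X]) :
    lieDensity a g (u + v) = lieDensity a g u + lieDensity a g v := by
  simp only [lieDensity, derivative_add, mul_add, smul_add]
  abel

theorem lieDensity_smul (a c : ℂ) (g u : ℂ[X]) :
    lieDensity a g (c • u) = c • lieDensity a g u := by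
  simp only [lieDensity, derivative_C_mul, smul_eq_C_mul]
  ring

theorem modelTerm_add (lam mu a : ℂ) (g : ℂ[X]) (d : ℕ) (u v : ℂ[X]) :
    modelTerm lam mu a g d (u + v) = modelTerm lam mu a g d u + modelTerm lam mu a g d v := by
  cases d <;> simp only [modelTerm, lieDensity_add, transvectant_add, smul_add]

theorem modelTerm_sum {ι : Type*} (lam mu a : ℂ) (g : ℂ[X]) (d : ℕ) (s : Finset ι)
    (u : ι → ℂ[X]) :
    modelTerm lam mu a g d (∑ j ∈ s, u j) = ∑ j ∈ s, modelTerm lam mu a g d (u j) := by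
  let F : ℂ[X] →+ ℂ[X] := AddMonoidHom.mk' (modelTerm lam mu a g d) (modelTerm_add lam mu a g d)
  exact map_sum F u s

theorem modelAction_apply (n lam mu : ℂ) (V : Vec) (w : ℕ → ℂ[X]) (i : Fin 5) :
    modelAction n (modelCoeff n lam mu) V (fun i => w i) i = ∑ j ∈ Finset.range (i + 1),
      modelTerm lam mu (n + j) V.coeff (i - j) (w j) := by
  fin_cases i <;>
    simp [modelAction, modelCoeff, modelTerm, transvectant, Fin.sum_univ_five,
      Finset.sum_range_succ] <;> ring

theorem two_mul_add_ne_zero_of_not_isResonant {n : ℂ} (hn : ¬ IsResonant 5 n) (m e : ℕ)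
    (h : e + 2 * m ≤ 6) : 2 * (n + m) + e ≠ 0 := by
  intro h0
  refine hn ⟨e + 2 * m, by omega, ?_⟩
  push_cast
  linear_combination h0 / 2

theorem quantMap_psiAction (n lam mu : ℂ) (hn : ¬ IsResonant 5 n) (V : Vec) (u : Psi) :
    quantMap n lam mu (psiAction (del lam mu - n) lam mu V u) =
      modelAction n (modelCoeff n lam mu) V (quantMap n lam mu u) := by
  have hr := two_mul_add_ne_zero_of_not_isResonant hn
  funext i
  have hi := i.2
  rw [quantMap_apply, quantize_apply]
  refine Eq.trans ?_ (modelAction_apply n lam mu V (quantize n lam mu u) i).symm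
  simp only [psiAction_apply, quantize_apply, modelTerm_sum, iterate_derivative_sum,
    Finset.smul_sum]
  have swap : ∀ f : ℕ → ℕ → ℂ[X],
      ∑ j ∈ Finset.range (i + 1), ∑ m ∈ Finset.range (j + 1), f j m =
        ∑ m ∈ Finset.range (i + 1), ∑ r ∈ Finset.range (i - m + 1), f (m + r) m := by
    intro f
    rw [Finset.sum_comm' (t' := Finset.range (i + 1))
      (s' := fun m => Finset.Ico m (i + 1)) (by simp; omega)]
    refine Finset.sum_congr rfl fun m hm => ?_
    have hm := Finset.mem_range.1 hm
    rw [Finset.sum_Ico_eq_sum_range, show (i : ℕ) + 1 - m = i - m + 1 by omega]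
  -- Collecting the terms in `u m` reduces the claim to the relation from weight `n + m` to `n + i`.
  rw [swap, swap]
  refine Finset.sum_congr rfl fun m hm => ?_
  have hm := Finset.mem_range.1 hm
  convert column lam mu (n + m) (i - m) (by omega) (fun e he => hr m e (by omega)) V.coeff (u m)
    using 3 <;> simp only [Nat.cast_add, add_assoc, Nat.sub_sub, Nat.add_sub_cancel_left]

/-- The isomorphism from the subquotient to its model induced by the projective quantization. -/
def quantEquiv (n lam mu : ℂ) : SQ 5 ≃ₗ[ℂ] Model :=
  (Submodule.quotEquivOfEq _ _ (ker_quantMap n lam mu).symm).trans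
    ((quantMap n lam mu).quotKerEquivOfSurjective (quantMap_surjective n lam mu))

theorem quantEquiv_mk (n lam mu : ℂ) (u : Psi) :
    quantEquiv n lam mu (Submodule.Quotient.mk u) = quantMap n lam mu u := rfl

theorem quantEquiv_sqAction (n lam mu : ℂ) (hn : ¬ IsResonant 5 n) (V : Vec) (u : SQ 5) :
    quantEquiv n lam mu (sqAction (del lam mu - n) 5 lam mu V u) =
      modelAction n (modelCoeff n lam mu) V (quantEquiv n lam mu u) := by
  obtain ⟨u, rfl⟩ := Submodule.Quotient.mk_surjective _ u
  rw [quantEquiv_mk, ← quantMap_psiAction n lam mu hn]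
  rfl

theorem sqEquiv_iff_model (n lam mu lam' mu' : ℂ) (hn : ¬ IsResonant 5 n) :
    SQEquiv 5 (del lam mu - n) lam mu (del lam' mu' - n) lam' mu' ↔
      ∃ ψ : Model ≃ₗ[ℂ] Model, ∀ (V : Vec) (w : Model),
        ψ (modelAction n (modelCoeff n lam mu) V w) =
          modelAction n (modelCoeff n lam' mu') V (ψ w) := by
  constructor
  · rintro ⟨φ, hφ⟩
    refine ⟨((quantEquiv n lam mu).symm.trans φ).trans (quantEquiv n lam' mu'), fun V w => ?_⟩
    obtain ⟨u, rfl⟩ := (quantEquiv n lam mu).surjective w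
    rw [← quantEquiv_sqAction n lam mu hn]
    simp only [LinearEquiv.trans_apply, LinearEquiv.symm_apply_apply]
    rw [hφ, quantEquiv_sqAction n lam' mu' hn]
  · rintro ⟨ψ, hψ⟩
    refine ⟨((quantEquiv n lam mu).trans ψ).trans (quantEquiv n lam' mu').symm, fun V u => ?_⟩
    simp only [LinearEquiv.trans_apply]
    rw [LinearEquiv.symm_apply_eq, quantEquiv_sqAction n lam' mu' hn,
      quantEquiv_sqAction n lam mu hn, hψ, LinearEquiv.apply_symm_apply]

/-! ### Rigidity of intertwiners between models -/

/-- The vector field `g ∂`. -/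
def field (g : ℂ[X]) : Vec := mkDerivation ℂ g

theorem coeff_field (g : ℂ[X]) : (field g).coeff = g := mkDerivation_X _ g

theorem lieDensity_zero (a : ℂ) (g : ℂ[X]) : lieDensity a g 0 = 0 := by simp [lieDensity]

theorem transvectant_zero_right (d : ℕ) (a : ℂ) (h : ℂ[X]) : transvectant d a h 0 = 0 := by
  simpa using transvectant_smul d a 0 h 0

theorem transvectant_zero_left (d : ℕ) (a : ℂ) (u : ℂ[X]) : transvectant d a 0 u = 0 := by
  unfold transvectant
  split <;> simp

theorem transvectant_of_lt (d : ℕ) (hd : d < 2) (a : ℂ) (h u : ℂ[X]) :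
    transvectant d a h u = 0 := by
  interval_cases d <;> rfl

theorem transvectant_C (d : ℕ) (hd : 2 ≤ d) (hd' : d ≤ 4) (a c : ℂ) (u : ℂ[X]) :
    transvectant d a (C c) u = C c * derivative^[d - 2] u := by
  interval_cases d <;> simp [transvectant]

theorem modelAction_single (n : ℂ) (b : Fin 5 → Fin 5 → ℂ) (V : Vec) (j : Fin 5) (u : ℂ[X])
    (i : Fin 5) :
    modelAction n b V (Pi.single j u) i =
      lieDensity (n + (i : ℕ)) V.coeff ((Pi.single j u : Model) i) +
        b i j • transvectant (i - j) (n + (j : ℕ)) (derivative^[3] V.coeff) u := by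
  rw [modelAction, Finset.sum_eq_single j]
  · rw [Pi.single_eq_same]
  · intro m _ hm
    rw [Pi.single_eq_of_ne hm, transvectant_zero_right, smul_zero]
  · simp

/-- On the projective subalgebra, where `g^(3) = 0`, the model is the direct sum of density
modules. -/
theorem modelAction_of_iterate_derivative_eq_zero (n : ℂ) (b : Fin 5 → Fin 5 → ℂ) (V : Vec)
    (hV : derivative^[3] V.coeff = 0) (w : Model) (i : Fin 5) :
    modelAction n b V w i = lieDensity (n + (i : ℕ)) V.coeff (w i) := by
  simp [modelAction, hV, transvectant_zero_left]

theorem modelAction_single_of_iterate_derivative_eq_zero (n : ℂ) (b : Fin 5 → Fin 5 → ℂ) (V : Vec)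
    (hV : derivative^[3] V.coeff = 0) (j : Fin 5) (u : ℂ[X]) :
    modelAction n b V (Pi.single j u) = Pi.single j (lieDensity (n + (j : ℕ)) V.coeff u) := by
  funext i
  rw [modelAction_of_iterate_derivative_eq_zero n b V hV]
  rcases eq_or_ne i j with rfl | h
  · simp
  · simp [Pi.single_eq_of_ne h, lieDensity_zero]

theorem modelAction_smul (n : ℂ) (b : Fin 5 → Fin 5 → ℂ) (V : Vec) (c : ℂ) (w : Model) :
    modelAction n b V (c • w) = c • modelAction n b V w := by
  funext i
  simp only [modelAction, Pi.smul_apply, lieDensity_smul, transvectant_smul, smul_add,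
    Finset.smul_sum]
  simp only [smul_comm c]

section Rigidity

variable {n : ℂ} {b b' : Fin 5 → Fin 5 → ℂ} {ψ : Model ≃ₗ[ℂ] Model}

/-- Commutation with `∂` sends constants to constants, and commutation with `x ∂` preserves their
weights, which are distinct. -/
theorem intertwiner_single_one
    (hψ : ∀ V w, ψ (modelAction n b V w) = modelAction n b' V (ψ w)) (j : Fin 5) :
    ∃ p : ℂ, p ≠ 0 ∧ ψ (Pi.single j 1) = p • Pi.single j 1 := by
  have hconst : ∀ i, derivative (ψ (Pi.single j 1) i) = 0 := by
    intro i
    have h := congrFun (hψ (field 1) (Pi.single j 1)) i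
    rw [modelAction_single_of_iterate_derivative_eq_zero _ _ _ (by simp [coeff_field]),
      modelAction_of_iterate_derivative_eq_zero _ _ _ (by simp [coeff_field])] at h
    simpa [lieDensity, coeff_field] using h.symm
  have hoff : ∀ i, i ≠ j → ψ (Pi.single j 1) i = 0 := by
    intro i hij
    have h := congrFun (hψ (field X) (Pi.single j 1)) i
    rw [modelAction_single_of_iterate_derivative_eq_zero _ _ _ (by simp [coeff_field]),
      modelAction_of_iterate_derivative_eq_zero _ _ _ (by simp [coeff_field])] at h
    have e : (Pi.single j (lieDensity (n + (j : ℕ)) (field X).coeff 1) : Model) =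
        (n + (j : ℕ)) • Pi.single j 1 := by
      rw [← Pi.single_smul]; simp [lieDensity, coeff_field]
    rw [e, map_smul, Pi.smul_apply] at h
    simp only [lieDensity, coeff_field, hconst i, mul_zero, derivative_X, one_mul, zero_add] at h
    rw [← sub_eq_zero, ← sub_smul, smul_eq_zero] at h
    refine h.resolve_left fun h0 => hij (Fin.ext ?_)
    have : ((i : ℕ) : ℂ) = (j : ℕ) := by linear_combination -h0
    exact_mod_cast this
  obtain ⟨p, hp⟩ : ∃ p : ℂ, ψ (Pi.single j 1) j = C p :=
    ⟨_, eq_C_of_derivative_eq_zero (hconst j)⟩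
  have h1 : ψ (Pi.single j 1) = p • Pi.single j 1 := by
    funext i
    rcases eq_or_ne i j with rfl | h
    · rw [hp]; simp [smul_eq_C_mul]
    · simp [hoff i h, Pi.single_eq_of_ne h]
  refine ⟨p, ?_, h1⟩
  rintro rfl
  rw [zero_smul, LinearEquiv.map_eq_zero_iff] at h1
  simpa using congrFun h1 j

/-- The operator `x² ∂` maps `x^r` to `(r + 2 (n + j)) x^(r+1)` in the component `j`. The factor is
non-zero in the stated range, so the scalar on constants propagates to higher powers. -/
theorem intertwiner_single_pow (hn : ¬ IsResonant 5 n)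
    (hψ : ∀ V w, ψ (modelAction n b V w) = modelAction n b' V (ψ w)) {j : Fin 5} {p : ℂ}
    (hp : ψ (Pi.single j 1) = p • Pi.single j 1) (r : ℕ) (hr : r = 0 ∨ r + 2 * j ≤ 7) :
    ψ (Pi.single j (X ^ r)) = p • Pi.single j (X ^ r) := by
  induction r with
  | zero => simpa using hp
  | succ r ih =>
    have hc : (r : ℂ) + 2 * (n + (j : ℕ)) ≠ 0 := by
      intro h0
      refine hn ⟨r + 2 * j, by omega, ?_⟩
      push_cast
      linear_combination h0 / 2
    have h := hψ (field (X ^ 2)) (Pi.single j (X ^ r))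
    have h3 : derivative^[3] (field (X ^ 2)).coeff = 0 := by
      simp [coeff_field, iterate_derivative_X_pow_eq_smul, Nat.descFactorial]
    have e : (Pi.single j (lieDensity (n + (j : ℕ)) (field (X ^ 2)).coeff (X ^ r)) : Model) =
        ((r : ℂ) + 2 * (n + (j : ℕ))) • Pi.single j (X ^ (r + 1)) := by
      rw [← Pi.single_smul]
      congr 1
      simp only [lieDensity, coeff_field, derivative_X_pow, smul_eq_C_mul]
      rcases r with _ | r
      · simp; ring
      · simp; ring
    rw [ih (by omega), modelAction_smul,
      modelAction_single_of_iterate_derivative_eq_zero _ _ _ h3,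
      modelAction_single_of_iterate_derivative_eq_zero _ _ _ h3, e, map_smul, smul_comm] at h
    exact smul_right_injective _ hc h

/-- The relation is the constant term, in the component `i`, of commutation with `x³ ∂` evaluated at
`x^(i-j-2)` in the component `j`. -/
theorem intertwiner_coeff (hn : ¬ IsResonant 5 n)
    (hψ : ∀ V w, ψ (modelAction n b V w) = modelAction n b' V (ψ w)) {p : Fin 5 → ℂ}
    (hp : ∀ j, ψ (Pi.single j 1) = p j • Pi.single j 1) (i j : Fin 5)
    (hij : (j : ℕ) + 2 ≤ i) : p i * b i j = b' i j * p j := by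
  have hi := i.2
  have h3 : derivative^[3] (field (X ^ 3)).coeff = C 6 := by
    rw [coeff_field, iterate_derivative_X_pow_eq_smul, Nat.sub_self, pow_zero, smul_eq_C_mul,
      mul_one, Nat.descFactorial_self]
    rfl
  set r : ℕ := i - j - 2 with hr
  have h := congrFun (hψ (field (X ^ 3)) (Pi.single j (X ^ r))) i
  set y : Model := modelAction n b (field (X ^ 3)) (Pi.single j (X ^ r)) with hy
  have hm : ∀ m, ψ (Pi.single m (y m)) = p m • Pi.single m (y m) := by
    intro m
    have hm5 := m.2
    -- The vector field raises weights by two, so the component `m` is a multiple of `x^(i - m)`.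
    have key : ∃ (c : ℂ) (s : ℕ), y m = c • X ^ s ∧ (s = 0 ∨ s + 2 * (m : ℕ) ≤ 7) := by
      rw [hy, modelAction_single, h3]
      rcases lt_trichotomy (m : ℕ) j with hlt | heq | hgt
      · refine ⟨0, 0, ?_, Or.inl rfl⟩
        rw [transvectant_of_lt _ (by omega), Pi.single_eq_of_ne (Fin.ne_of_lt hlt), lieDensity_zero]
        simp
      · obtain rfl : m = j := Fin.ext heq
        refine ⟨r + 3 * (n + (m : ℕ)), r + 2, ?_, Or.inr (by omega)⟩
        rw [transvectant_of_lt _ (by omega), Pi.single_eq_same]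
        simp only [lieDensity, coeff_field, derivative_X_pow, smul_eq_C_mul]
        generalize r = r
        rcases r with _ | r
        · simp; ring
        · simp; ring
      · have hne : m ≠ j := (Fin.ne_of_lt hgt).symm
        rw [Pi.single_eq_of_ne hne, lieDensity_zero, zero_add]
        by_cases h1 : (m : ℕ) - j < 2
        · exact ⟨0, 0, by rw [transvectant_of_lt _ h1]; simp, Or.inl rfl⟩
        · rw [transvectant_C _ (by omega) (by omega), iterate_derivative_X_pow_eq_smul]
          by_cases h2 : (m : ℕ) ≤ i
          · refine ⟨b m j * (6 * (r.descFactorial (m - j - 2) : ℂ)), r - (m - j - 2), ?_, by omega⟩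
            simp [smul_eq_C_mul, mul_assoc]
          · refine ⟨0, 0, ?_, Or.inl rfl⟩
            rw [Nat.descFactorial_of_lt (by omega)]
            simp
    obtain ⟨c, s, e, hs⟩ := key
    rw [e, Pi.single_smul, map_smul, intertwiner_single_pow hn hψ (hp m) s hs, smul_comm]
  have hψy : ψ y i = p i • y i := by
    conv_lhs => rw [← Finset.univ_sum_single y]
    rw [map_sum, Finset.sum_apply, Finset.sum_eq_single i]
    · rw [hm, Pi.smul_apply, Pi.single_eq_same]
    · intro m _ hmi
      rw [hm, Pi.smul_apply, Pi.single_eq_of_ne hmi.symm, smul_zero]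
    · simp
  have hne : i ≠ j := by rintro rfl; omega
  have hcomp : ∀ b : Fin 5 → Fin 5 → ℂ,
      modelAction n b (field (X ^ 3)) (Pi.single j (X ^ r)) i =
        C (b i j * 6 * (r.factorial : ℂ)) := by
    intro b
    rw [modelAction_single, h3, Pi.single_eq_of_ne hne, lieDensity_zero, zero_add,
      transvectant_C _ (by omega) (by omega), iterate_derivative_X_pow_eq_smul,
      show (i : ℕ) - j - 2 = r from rfl, Nat.descFactorial_self]
    simp [smul_eq_C_mul, mul_assoc]
  rw [hψy, intertwiner_single_pow hn hψ (hp j) r (by omega), modelAction_smul, Pi.smul_apply, hy,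
    hcomp, hcomp, smul_eq_C_mul, smul_eq_C_mul, ← C_mul, ← C_mul] at h
  have h6 := C_injective h
  have hf : (r.factorial : ℂ) ≠ 0 := Nat.cast_ne_zero.2 r.factorial_ne_zero
  refine mul_right_cancel₀ hf (mul_right_cancel₀ (show (6 : ℂ) ≠ 0 by norm_num) ?_)
  linear_combination h6

end Rigidity

theorem exists_intertwiner_iff {n : ℂ} (hn : ¬ IsResonant 5 n) (b b' : Fin 5 → Fin 5 → ℂ) :
    (∃ ψ : Model ≃ₗ[ℂ] Model, ∀ (V : Vec) (w : Model),
        ψ (modelAction n b V w) = modelAction n b' V (ψ w)) ↔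
      ∃ p : Fin 5 → ℂ, (∀ i, p i ≠ 0) ∧
        ∀ i j : Fin 5, (j : ℕ) + 2 ≤ i → p i * b i j = b' i j * p j := by
  constructor
  · rintro ⟨ψ, hψ⟩
    choose p hp0 hp using intertwiner_single_one hψ
    exact ⟨p, hp0, intertwiner_coeff hn hψ hp⟩
  · rintro ⟨p, hp0, hp⟩
    refine ⟨LinearEquiv.piCongrRight fun i => LinearEquiv.smulOfNeZero ℂ _ (p i) (hp0 i),
      fun V w => funext fun i => ?_⟩
    simp only [modelAction, LinearEquiv.piCongrRight_apply, LinearEquiv.smulOfNeZero_apply,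
      smul_add, Finset.smul_sum, lieDensity_smul, transvectant_smul, smul_smul]
    congr 1
    refine Finset.sum_congr rfl fun j _ => ?_
    by_cases h : (j : ℕ) + 2 ≤ i
    · rw [hp i j h]
    · rw [transvectant_of_lt _ (by omega), smul_zero, smul_zero]

/-! ### Diagonal intertwiners and cycles of the weight graph -/

/-- Along an edge with matching vanishing, a non-zero value at the tail `j` extends to the head
`i`. -/
theorem exists_head {x y p : ℂ} (h : x = 0 ↔ y = 0) (hp : p ≠ 0) : ∃ q ≠ 0, q * x = y * p := by
  by_cases hx : x = 0
  · exact ⟨1, one_ne_zero, by rw [hx, h.1 hx]; ring⟩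
  · exact ⟨y * p / x, div_ne_zero (mul_ne_zero (mt h.2 hx) hp) hx, by field_simp⟩

/-- Along an edge with matching vanishing, a non-zero value at the head `i` extends to the tail
`j`. -/
theorem exists_tail {x y p : ℂ} (h : x = 0 ↔ y = 0) (hp : p ≠ 0) : ∃ q ≠ 0, p * x = y * q := by
  obtain ⟨q, hq, e⟩ := exists_head h.symm hp
  exact ⟨q, hq, by linear_combination -e⟩

theorem zero_iff_of_scale {x y p q : ℂ} (hp : p ≠ 0) (hq : q ≠ 0) (h : p * x = y * q) :
    x = 0 ↔ y = 0 := by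
  constructor
  · rintro rfl
    rw [mul_zero] at h
    exact (mul_eq_zero.1 h.symm).resolve_right hq
  · rintro rfl
    rw [zero_mul] at h
    exact (mul_eq_zero.1 h).resolve_left hp

/-- Solvability of `p i * x i j = y i j * p j` on the graph with edges `(i, j)`, `j + 2 ≤ i`. The
graph consists of three paths from `4` to `0`, and `α` plays the role of `p 4 / p 0`. -/
theorem exists_diagonal_iff (x y : Fin 5 → Fin 5 → ℂ) :
    (∃ p : Fin 5 → ℂ, (∀ i, p i ≠ 0) ∧
        ∀ i j : Fin 5, (j : ℕ) + 2 ≤ i → p i * x i j = y i j * p j) ↔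
      (∀ i j : Fin 5, (j : ℕ) + 2 ≤ i → (x i j = 0 ↔ y i j = 0)) ∧
      ∃ α : ℂ, α ≠ 0 ∧
        (x 4 2 * x 2 0 ≠ 0 → α * (x 4 2 * x 2 0) = y 4 2 * y 2 0) ∧
        (x 4 0 ≠ 0 → α * x 4 0 = y 4 0) ∧
        (x 4 1 * x 3 0 * x 3 1 ≠ 0 →
          α * (x 4 1 * x 3 0 * y 3 1) = y 4 1 * y 3 0 * x 3 1) := by
  constructor
  · rintro ⟨p, hp0, hp⟩
    refine ⟨fun i j hij => zero_iff_of_scale (hp0 i) (hp0 j) (hp i j hij), p 4 / p 0,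
      div_ne_zero (hp0 4) (hp0 0), fun _ => ?_, fun _ => ?_, fun _ => ?_⟩
    · have h1 := hp 4 2 (by decide)
      have h2 := hp 2 0 (by decide)
      rw [div_mul_eq_mul_div, div_eq_iff (hp0 0)]
      linear_combination x 2 0 * h1 + y 4 2 * h2
    · have h1 := hp 4 0 (by decide)
      rw [div_mul_eq_mul_div, div_eq_iff (hp0 0)]
      exact h1
    · have h1 := hp 4 1 (by decide)
      have h2 := hp 3 0 (by decide)
      have h3 := hp 3 1 (by decide)
      rw [div_mul_eq_mul_div, div_eq_iff (hp0 0)]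
      linear_combination x 3 0 * y 3 1 * h1 - y 4 1 * x 3 0 * h3 + y 4 1 * x 3 1 * h2
  · rintro ⟨h0, α, hα, h420, h40, h4130⟩
    -- The endpoints get the values `p 0 = 1` and `p 4 = α`; each path is then filled separately.
    obtain ⟨p2, hp2, e42, e20⟩ : ∃ p2 ≠ 0, α * x 4 2 = y 4 2 * p2 ∧ p2 * x 2 0 = y 2 0 * 1 := by
      have z42 := h0 4 2 (by decide)
      have z20 := h0 2 0 (by decide)
      by_cases hx : x 4 2 = 0
      · obtain ⟨q, hq, e⟩ := exists_head z20 one_ne_zero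
        exact ⟨q, hq, by rw [hx, z42.1 hx]; ring, e⟩
      · obtain ⟨q, hq, e⟩ := exists_tail z42 hα
        refine ⟨q, hq, e, ?_⟩
        by_cases hx' : x 2 0 = 0
        · rw [hx', z20.1 hx']; ring
        · have h := h420 (mul_ne_zero hx hx')
          refine mul_left_cancel₀ (mt z42.2 hx) ?_
          linear_combination h - x 2 0 * e
    have e40 : α * x 4 0 = y 4 0 * 1 := by
      by_cases hx : x 4 0 = 0
      · rw [hx, (h0 4 0 (by decide)).1 hx]; ring
      · rw [h40 hx, mul_one]
    obtain ⟨p1, hp1, p3, hp3, e41, e31, e30⟩ : ∃ p1 ≠ 0, ∃ p3 ≠ 0,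
        α * x 4 1 = y 4 1 * p1 ∧ p3 * x 3 1 = y 3 1 * p1 ∧ p3 * x 3 0 = y 3 0 * 1 := by
      have z41 := h0 4 1 (by decide)
      have z30 := h0 3 0 (by decide)
      have z31 := h0 3 1 (by decide)
      by_cases hx : x 4 1 = 0
      · obtain ⟨p3, hp3, e30⟩ := exists_head z30 one_ne_zero
        obtain ⟨p1, hp1, e31⟩ := exists_tail z31 hp3
        exact ⟨p1, hp1, p3, hp3, by rw [hx, z41.1 hx]; ring, e31, e30⟩
      · obtain ⟨p1, hp1, e41⟩ := exists_tail z41 hα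
        by_cases hx' : x 3 1 = 0
        · obtain ⟨p3, hp3, e30⟩ := exists_head z30 one_ne_zero
          exact ⟨p1, hp1, p3, hp3, e41, by rw [hx', z31.1 hx']; ring, e30⟩
        · obtain ⟨p3, hp3, e31⟩ := exists_head z31 hp1
          refine ⟨p1, hp1, p3, hp3, e41, e31, ?_⟩
          by_cases hx'' : x 3 0 = 0
          · rw [hx'', z30.1 hx'']; ring
          · have h := h4130 (mul_ne_zero (mul_ne_zero hx hx'') hx')
            refine mul_left_cancel₀ (mul_ne_zero (mt z41.2 hx) hx') ?_
            linear_combination h - x 3 0 * y 3 1 * e41 + y 4 1 * x 3 0 * e31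
    refine ⟨![1, p1, p2, p3, α], ?_, ?_⟩
    · intro i
      fin_cases i
      exacts [one_ne_zero, hp1, hp2, hp3, hα]
    · intro i j hij
      fin_cases i <;> fin_cases j <;> first | (exfalso; revert hij; decide) | assumption

/-- One scalar must satisfy up to three conditions, one for each non-vanishing path. If at most one
is present it can be solved; otherwise the scalar can be eliminated, which leaves equalities of
ratios. -/
theorem exists_scale_iff {X Y Z W X' Y' Z' W' : ℂ} (hX : X = 0 ↔ X' = 0) (hY : Y = 0 ↔ Y' = 0)
    (hZ : Z = 0 ↔ Z' = 0) (hW : W = 0 ↔ W' = 0) :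
    (∃ α : ℂ, α ≠ 0 ∧ (X ≠ 0 → α * X = X') ∧ (Y ≠ 0 → α * Y = Y') ∧
        (Z * W ≠ 0 → α * (Z * W') = Z' * W)) ↔
      ((Y = 0 ∧ X = 0) ∨ (Y = 0 ∧ Z * W = 0) ∨ (X = 0 ∧ Z * W = 0)) ∨
      (Y * X ≠ 0 ∧ Z * W = 0 ∧ Y / X = Y' / X') ∨
      (Y * (Z * W) ≠ 0 ∧ X = 0 ∧ Y * W / Z = Y' * W' / Z') ∨
      (Z * W * X ≠ 0 ∧ Y = 0 ∧ X * W / Z = X' * W' / Z') ∨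
      (Y * X * (Z * W) ≠ 0 ∧ Y / X = Y' / X' ∧ Y * W / Z = Y' * W' / Z') := by
  have hZW : Z * W = 0 ↔ Z' * W' = 0 := by rw [mul_eq_zero, mul_eq_zero, hZ, hW]
  have hsplit : Z * W ≠ 0 → Z ≠ 0 ∧ W ≠ 0 ∧ Z' ≠ 0 ∧ W' ≠ 0 := fun h =>
    ⟨left_ne_zero_of_mul h, right_ne_zero_of_mul h, left_ne_zero_of_mul (mt hZW.2 h),
      right_ne_zero_of_mul (mt hZW.2 h)⟩
  constructor
  · rintro ⟨α, hα, eX, eY, eZ⟩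
    have hI : X ≠ 0 → Y ≠ 0 → Y / X = Y' / X' := by
      intro x0 y0
      rw [← eX x0, ← eY y0, mul_div_mul_left _ _ hα]
    have hJ : Y ≠ 0 → Z * W ≠ 0 → Y * W / Z = Y' * W' / Z' := by
      intro y0 z0
      obtain ⟨z, w, z', w'⟩ := hsplit z0
      rw [← eY y0, div_eq_div_iff z z']
      linear_combination -Y * eZ z0
    have hK : X ≠ 0 → Z * W ≠ 0 → X * W / Z = X' * W' / Z' := by
      intro x0 z0
      obtain ⟨z, w, z', w'⟩ := hsplit z0
      rw [← eX x0, div_eq_div_iff z z']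
      linear_combination -X * eZ z0
    have hne : ∀ {a b : ℂ}, a ≠ 0 → b ≠ 0 → a * b ≠ 0 := mul_ne_zero
    by_cases x0 : X = 0
    · by_cases y0 : Y = 0
      · exact Or.inl (Or.inl ⟨y0, x0⟩)
      · by_cases z0 : Z * W = 0
        · exact Or.inl (Or.inr (Or.inr ⟨x0, z0⟩))
        · exact Or.inr (Or.inr (Or.inl ⟨hne y0 z0, x0, hJ y0 z0⟩))
    · by_cases y0 : Y = 0
      · by_cases z0 : Z * W = 0
        · exact Or.inl (Or.inr (Or.inl ⟨y0, z0⟩))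
        · exact Or.inr (Or.inr (Or.inr (Or.inl ⟨hne z0 x0, y0, hK x0 z0⟩)))
      · by_cases z0 : Z * W = 0
        · exact Or.inr (Or.inl ⟨hne y0 x0, z0, hI x0 y0⟩)
        · exact Or.inr (Or.inr (Or.inr (Or.inr ⟨hne (hne y0 x0) z0, hI x0 y0, hJ y0 z0⟩)))
  · have scaleX : X ≠ 0 → ∃ α ≠ 0, α * X = X' := fun h =>
      ⟨X' / X, div_ne_zero (mt hX.2 h) h, div_mul_cancel₀ _ h⟩
    have scaleY : Y ≠ 0 → ∃ α ≠ 0, α * Y = Y' := fun h =>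
      ⟨Y' / Y, div_ne_zero (mt hY.2 h) h, div_mul_cancel₀ _ h⟩
    have scaleZ : Z * W ≠ 0 → ∃ α ≠ 0, α * (Z * W') = Z' * W := fun h => by
      obtain ⟨z, w, z', w'⟩ := hsplit h
      exact ⟨Z' * W / (Z * W'), div_ne_zero (mul_ne_zero z' w) (mul_ne_zero z w'),
        div_mul_cancel₀ _ (mul_ne_zero z w')⟩
    rintro ((⟨y0, x0⟩ | ⟨y0, z0⟩ | ⟨x0, z0⟩) | ⟨h, z0, hI⟩ | ⟨h, x0, hJ⟩ | ⟨h, y0, hK⟩ |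
      ⟨h, hI, hJ⟩)
    · by_cases z0 : Z * W = 0
      · exact ⟨1, one_ne_zero, fun h => (h x0).elim, fun h => (h y0).elim, fun h => (h z0).elim⟩
      · obtain ⟨α, hα, e⟩ := scaleZ z0
        exact ⟨α, hα, fun h => (h x0).elim, fun h => (h y0).elim, fun _ => e⟩
    · by_cases x0 : X = 0
      · exact ⟨1, one_ne_zero, fun h => (h x0).elim, fun h => (h y0).elim, fun h => (h z0).elim⟩
      · obtain ⟨α, hα, e⟩ := scaleX x0
        exact ⟨α, hα, fun _ => e, fun h => (h y0).elim, fun h => (h z0).elim⟩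
    · by_cases y0 : Y = 0
      · exact ⟨1, one_ne_zero, fun h => (h x0).elim, fun h => (h y0).elim, fun h => (h z0).elim⟩
      · obtain ⟨α, hα, e⟩ := scaleY y0
        exact ⟨α, hα, fun h => (h x0).elim, fun _ => e, fun h => (h z0).elim⟩
    · have y0 := left_ne_zero_of_mul h
      have x0 := right_ne_zero_of_mul h
      obtain ⟨α, hα, e⟩ := scaleY y0
      rw [div_eq_div_iff x0 (mt hX.2 x0)] at hI
      refine ⟨α, hα, fun _ => mul_left_cancel₀ y0 ?_, fun _ => e, fun h => (h z0).elim⟩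
      linear_combination X * e - hI
    · have y0 := left_ne_zero_of_mul h
      obtain ⟨z, w, z', w'⟩ := hsplit (right_ne_zero_of_mul h)
      obtain ⟨α, hα, e⟩ := scaleY y0
      rw [div_eq_div_iff z z'] at hJ
      refine ⟨α, hα, fun h => (h x0).elim, fun _ => e, fun _ => mul_left_cancel₀ y0 ?_⟩
      linear_combination Z * W' * e - hJ
    · have x0 := right_ne_zero_of_mul h
      obtain ⟨z, w, z', w'⟩ := hsplit (left_ne_zero_of_mul h)
      obtain ⟨α, hα, e⟩ := scaleX x0
      rw [div_eq_div_iff z z'] at hK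
      refine ⟨α, hα, fun _ => e, fun h => (h y0).elim, fun _ => mul_left_cancel₀ x0 ?_⟩
      linear_combination Z * W' * e - hK
    · have y0 := left_ne_zero_of_mul (left_ne_zero_of_mul h)
      have x0 := right_ne_zero_of_mul (left_ne_zero_of_mul h)
      obtain ⟨z, w, z', w'⟩ := hsplit (right_ne_zero_of_mul h)
      obtain ⟨α, hα, e⟩ := scaleY y0
      rw [div_eq_div_iff x0 (mt hX.2 x0)] at hI
      rw [div_eq_div_iff z z'] at hJ
      refine ⟨α, hα, fun _ => mul_left_cancel₀ y0 ?_, fun _ => e,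
        fun _ => mul_left_cancel₀ y0 ?_⟩
      · linear_combination X * e - hI
      · linear_combination Z * W' * e - hJ

/-! ### Classification of the subquotients -/

/-- The function `(δ - n - j)_{i-j} B_{n+i,n+j}` attached to the edge `(i, j)`. -/
def edge (n lam mu : ℂ) (i j : Fin 5) : ℂ :=
  falling (del lam mu - (n + (j : ℕ))) (i - j) * B lam mu (n + (j : ℕ)) (i - j)

theorem cocycleNorm_ne_zero {n : ℂ} (hn : ¬ IsResonant 5 n) (i j : Fin 5)
    (hij : (j : ℕ) + 2 ≤ i) : cocycleNorm (n + (j : ℕ)) (i - j) ≠ 0 := by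
  have hi := i.2
  generalize (i : ℕ) = i' at *
  generalize (j : ℕ) = j' at *
  obtain ⟨d, rfl⟩ := Nat.exists_eq_add_of_le (show j' ≤ i' by omega)
  have h := fun e he => two_mul_add_ne_zero_of_not_isResonant hn j' e he
  have hs := sqrt_three_ne_zero
  rw [Nat.add_sub_cancel_left]
  have h2 : 2 ≤ d := by omega
  have h4 : d ≤ 4 := by omega
  interval_cases d
  · have h1 := h 1 (by omega)
    rw [Nat.cast_one] at h1
    exact div_ne_zero (by norm_num) (mul_ne_zero (by norm_num) h1)
  · have h0 := h 0 (by omega)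
    have h2 := h 2 (by omega)
    have h4 := h 4 (by omega)
    simp only [Nat.cast_zero, add_zero, Nat.cast_ofNat] at h0 h2 h4
    exact div_ne_zero (by norm_num)
      (mul_ne_zero (mul_ne_zero (by norm_num) hs) (mul_ne_zero (mul_ne_zero h0 h2) h4))
  · have h0 := h 0 (by omega)
    have h1 := h 1 (by omega)
    have h3 := h 3 (by omega)
    have h5 := h 5 (by omega)
    have h6 := h 6 (by omega)
    simp only [Nat.cast_zero, add_zero, Nat.cast_one, Nat.cast_ofNat] at h0 h1 h3 h5 h6
    exact div_ne_zero (by norm_num) (mul_ne_zero (by norm_num)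
      (mul_ne_zero (mul_ne_zero (mul_ne_zero (mul_ne_zero h0 h1) h3) h5) h6))

theorem sqEquiv_iff_edge {n : ℂ} (hn : ¬ IsResonant 5 n) (lam mu lam' mu' : ℂ) :
    SQEquiv 5 (del lam mu - n) lam mu (del lam' mu' - n) lam' mu' ↔
      (∀ i j : Fin 5, (j : ℕ) + 2 ≤ i → (edge n lam mu i j = 0 ↔ edge n lam' mu' i j = 0)) ∧
      ∃ α : ℂ, α ≠ 0 ∧
        (edge n lam mu 4 2 * edge n lam mu 2 0 ≠ 0 →
          α * (edge n lam mu 4 2 * edge n lam mu 2 0) =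
            edge n lam' mu' 4 2 * edge n lam' mu' 2 0) ∧
        (edge n lam mu 4 0 ≠ 0 → α * edge n lam mu 4 0 = edge n lam' mu' 4 0) ∧
        (edge n lam mu 4 1 * edge n lam mu 3 0 * edge n lam mu 3 1 ≠ 0 →
          α * (edge n lam mu 4 1 * edge n lam mu 3 0 * edge n lam' mu' 3 1) =
            edge n lam' mu' 4 1 * edge n lam' mu' 3 0 * edge n lam mu 3 1) := by
  rw [sqEquiv_iff_model _ _ _ _ _ hn, exists_intertwiner_iff hn, ← exists_diagonal_iff]
  refine exists_congr fun p => and_congr_right fun _ => forall₃_congr fun i j hij => ?_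
  have hc := cocycleNorm_ne_zero hn i j hij
  simp only [modelCoeff, cocycleCoeff, edge]
  constructor
  · intro h
    refine mul_right_cancel₀ hc ?_
    linear_combination h
  · intro h
    linear_combination cocycleNorm (n + (j : ℕ)) (i - j) * h

theorem edge_eq (n lam mu : ℂ) :
    edge n lam mu 2 0 = falling (del lam mu - n) 2 * B₂ n lam mu ∧
    edge n lam mu 3 1 = falling (del lam mu - n - 1) 2 * B₂ (n + 1) lam mu ∧
    edge n lam mu 4 2 = falling (del lam mu - n - 2) 2 * B₂ (n + 2) lam mu ∧
    edge n lam mu 3 0 = falling (del lam mu - n) 3 * B₃ n lam mu ∧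
    edge n lam mu 4 1 = falling (del lam mu - n - 1) 3 * B₃ (n + 1) lam mu ∧
    edge n lam mu 4 0 = falling (del lam mu - n) 4 * B₄ n lam mu := by
  simp [edge, B, sub_sub]

theorem svc_iff (n lam mu lam' mu' : ℂ) : SVC n lam mu lam' mu' ↔
    ∀ i j : Fin 5, (j : ℕ) + 2 ≤ i → (edge n lam mu i j = 0 ↔ edge n lam' mu' i j = 0) := by
  obtain ⟨e20, e31, e42, e30, e41, e40⟩ := edge_eq n lam mu
  obtain ⟨e20', e31', e42', e30', e41', e40'⟩ := edge_eq n lam' mu'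
  simp only [SVC, SimVanish]
  rw [← e20, ← e31, ← e42, ← e30, ← e41, ← e40, ← e20', ← e31', ← e42', ← e30', ← e41', ← e40']
  constructor
  · rintro ⟨h20, h31, h42, h30, h41, h40⟩ i j hij
    fin_cases i <;> fin_cases j <;> first | (exfalso; revert hij; decide) | assumption
  · intro h
    exact ⟨h 2 0 (by decide), h 3 1 (by decide), h 4 2 (by decide), h 3 0 (by decide),
      h 4 1 (by decide), h 4 0 (by decide)⟩

theorem falling_eval (x : ℂ) :
    falling x 2 = x * (x - 1) ∧ falling x 3 = x * (x - 1) * (x - 2) ∧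
      falling x 4 = x * (x - 1) * (x - 2) * (x - 3) := by
  simp [falling, Finset.prod_range_succ]

/-- If `δ - n ∈ {0, 1, 2, 3}`, each of the three paths from `4` to `0` has a vanishing edge. -/
theorem edge_paths_eq_zero {n lam mu : ℂ} (h : falling (del lam mu - n) 4 = 0) :
    edge n lam mu 4 2 * edge n lam mu 2 0 = 0 ∧ edge n lam mu 4 0 = 0 ∧
      edge n lam mu 4 1 * edge n lam mu 3 0 = 0 := by
  obtain ⟨e20, -, e42, e30, e41, e40⟩ := edge_eq n lam mu
  rw [e20, e42, e30, e41, e40]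
  generalize del lam mu - n = x at *
  simp only [(falling_eval _).1, (falling_eval _).2.1, (falling_eval _).2.2] at h ⊢
  refine ⟨?_, ?_, ?_⟩
  · linear_combination B₂ (n + 2) lam mu * B₂ n lam mu * h
  · linear_combination B₄ n lam mu * h
  · linear_combination B₃ (n + 1) lam mu * B₃ n lam mu * (x - 1) * (x - 2) * h

theorem sqEquiv_iff_svc_of_falling_eq_zero {n : ℂ} (hn : ¬ IsResonant 5 n)
    (lam mu lam' mu' : ℂ)
    (h : falling (del lam mu - n) 4 * falling (del lam' mu' - n) 4 = 0) :
    SQEquiv 5 (del lam mu - n) lam mu (del lam' mu' - n) lam' mu' ↔ SVC n lam mu lam' mu' := by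
  rw [sqEquiv_iff_edge hn, ← svc_iff, and_iff_left_iff_imp, svc_iff]
  intro hs
  have hz : edge n lam mu 4 2 * edge n lam mu 2 0 = 0 ∧ edge n lam mu 4 0 = 0 ∧
      edge n lam mu 4 1 * edge n lam mu 3 0 = 0 := by
    rcases mul_eq_zero.1 h with h | h
    · exact edge_paths_eq_zero h
    · have := edge_paths_eq_zero h
      simpa only [mul_eq_zero, hs 4 2 (by decide), hs 2 0 (by decide), hs 4 0 (by decide),
        hs 4 1 (by decide), hs 3 0 (by decide)] using this
  exact ⟨1, one_ne_zero, fun h => (h hz.1).elim, fun h => (h hz.2.1).elim,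
    fun h => (left_ne_zero_of_mul h hz.2.2).elim⟩

theorem falling_ne_zero {x : ℂ} (h : falling x 4 ≠ 0) :
    falling x 2 ≠ 0 ∧ falling x 3 ≠ 0 ∧ falling (x - 1) 2 ≠ 0 ∧ falling (x - 1) 3 ≠ 0 ∧
      falling (x - 2) 2 ≠ 0 := by
  simp only [(falling_eval _).1, (falling_eval _).2.1, (falling_eval _).2.2] at h ⊢
  have e2 : x - 1 - 1 = x - 2 := by ring
  have e3 : x - 1 - 2 = x - 3 := by ring
  have e3' : x - 2 - 1 = x - 3 := by ring
  rw [e2, e3, e3']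
  simp only [mul_ne_zero_iff] at h ⊢
  tauto

theorem svc_iff_of_falling_ne_zero {n lam mu lam' mu' : ℂ}
    (h : falling (del lam mu - n) 4 ≠ 0) (h' : falling (del lam' mu' - n) 4 ≠ 0) :
    SVC n lam mu lam' mu' ↔
      (B₂ n lam mu = 0 ↔ B₂ n lam' mu' = 0) ∧
      (B₂ (n + 1) lam mu = 0 ↔ B₂ (n + 1) lam' mu' = 0) ∧
      (B₂ (n + 2) lam mu = 0 ↔ B₂ (n + 2) lam' mu' = 0) ∧
      (B₃ n lam mu = 0 ↔ B₃ n lam' mu' = 0) ∧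
      (B₃ (n + 1) lam mu = 0 ↔ B₃ (n + 1) lam' mu' = 0) ∧
      (B₄ n lam mu = 0 ↔ B₄ n lam' mu' = 0) := by
  obtain ⟨f1, f2, f3, f4, f5⟩ := falling_ne_zero h
  obtain ⟨f1', f2', f3', f4', f5'⟩ := falling_ne_zero h'
  simp only [SVC, SimVanish, mul_eq_zero, f1, f2, f3, f4, f5, f1', f2', f3', f4', f5', h, h',
    false_or]

/-- The products of falling factorials along the three paths from `4` to `0` agree (up to the
orientation of the edge `(3, 1)`) and equal `(δ - n)_4`, so they rescale the common ratio `α`. -/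
theorem sqEquiv_iff_of_falling_ne_zero {n : ℂ} (hn : ¬ IsResonant 5 n) {lam mu lam' mu' : ℂ}
    (h : falling (del lam mu - n) 4 ≠ 0) (h' : falling (del lam' mu' - n) 4 ≠ 0) :
    SQEquiv 5 (del lam mu - n) lam mu (del lam' mu' - n) lam' mu' ↔
      SVC n lam mu lam' mu' ∧ ∃ α : ℂ, α ≠ 0 ∧
        (B₂ (n + 2) lam mu * B₂ n lam mu ≠ 0 →
          α * (B₂ (n + 2) lam mu * B₂ n lam mu) = B₂ (n + 2) lam' mu' * B₂ n lam' mu') ∧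
        (B₄ n lam mu ≠ 0 → α * B₄ n lam mu = B₄ n lam' mu') ∧
        (B₃ (n + 1) lam mu * B₃ n lam mu * B₂ (n + 1) lam mu ≠ 0 →
          α * (B₃ (n + 1) lam mu * B₃ n lam mu * B₂ (n + 1) lam' mu') =
            B₃ (n + 1) lam' mu' * B₃ n lam' mu' * B₂ (n + 1) lam mu) := by
  rw [sqEquiv_iff_edge hn, ← svc_iff]
  refine and_congr_right fun _ => ?_
  obtain ⟨e20, e31, e42, e30, e41, e40⟩ := edge_eq n lam mu
  obtain ⟨e20', e31', e42', e30', e41', e40'⟩ := edge_eq n lam' mu'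
  rw [e20, e31, e42, e30, e41, e40, e20', e31', e42', e30', e41', e40']
  obtain ⟨f1, f2, f3, f4, f5⟩ := falling_ne_zero h
  obtain ⟨f1', f2', f3', f4', f5'⟩ := falling_ne_zero h'
  have ec : ∀ x : ℂ, falling (x - 2) 2 * falling x 2 = falling x 4 := by
    intro x; simp only [(falling_eval _).1, (falling_eval _).2.2]; ring
  have es : ∀ x : ℂ, falling (x - 1) 3 * falling x 3 = falling x 4 * falling (x - 1) 2 := by
    intro x; simp only [(falling_eval _).1, (falling_eval _).2.1, (falling_eval _).2.2]; ring
  have g1 := ec (del lam mu - n)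
  have g2 := es (del lam mu - n)
  have g1' := ec (del lam' mu' - n)
  have g2' := es (del lam' mu' - n)
  generalize falling (del lam mu - n) 4 = c at *
  generalize falling (del lam' mu' - n) 4 = c' at *
  generalize falling (del lam mu - n) 2 = c1 at *
  generalize falling (del lam mu - n) 3 = c2 at *
  generalize falling (del lam mu - n - 1) 2 = c3 at *
  generalize falling (del lam mu - n - 1) 3 = c4 at *
  generalize falling (del lam mu - n - 2) 2 = c5 at *
  generalize falling (del lam' mu' - n) 2 = c1' at *
  generalize falling (del lam' mu' - n) 3 = c2' at *
  generalize falling (del lam' mu' - n - 1) 2 = c3' at *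
  generalize falling (del lam' mu' - n - 1) 3 = c4' at *
  generalize falling (del lam' mu' - n - 2) 2 = c5' at *
  constructor
  · rintro ⟨β, hβ, h1, h2, h3⟩
    obtain ⟨α, hα, e⟩ : ∃ α ≠ 0, c' * α = β * c :=
      ⟨β * c / c', div_ne_zero (mul_ne_zero hβ h) h', mul_div_cancel₀ _ h'⟩
    refine ⟨α, hα, fun hX => mul_left_cancel₀ h' ?_, fun hY => mul_left_cancel₀ h' ?_,
      fun hZ => mul_left_cancel₀ (mul_ne_zero h' (mul_ne_zero f3 f3')) ?_⟩
    · have hx := h1 (by simp only [mul_ne_zero_iff] at hX ⊢; tauto)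
      linear_combination hx + (B₂ (n + 2) lam mu * B₂ n lam mu) * (e - β * g1) +
        (B₂ (n + 2) lam' mu' * B₂ n lam' mu') * g1'
    · have hy := h2 (mul_ne_zero h hY)
      linear_combination hy + B₄ n lam mu * e
    · have hz := h3 (by simp only [mul_ne_zero_iff] at hZ ⊢; tauto)
      linear_combination hz +
        (B₃ (n + 1) lam mu * B₃ n lam mu * B₂ (n + 1) lam' mu' * c3') * (c3 * e - β * g2) +
        (B₃ (n + 1) lam' mu' * B₃ n lam' mu' * B₂ (n + 1) lam mu * c3) * g2'
  · rintro ⟨α, hα, h1, h2, h3⟩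
    obtain ⟨β, hβ, e⟩ : ∃ β ≠ 0, c' * α = β * c :=
      ⟨c' * α / c, div_ne_zero (mul_ne_zero h' hα) h, (div_mul_cancel₀ _ h).symm⟩
    refine ⟨β, hβ, fun hX => ?_, fun hY => ?_, fun hZ => ?_⟩
    · have hx := h1 (by simp only [mul_ne_zero_iff] at hX ⊢; tauto)
      linear_combination c' * hx - (B₂ (n + 2) lam mu * B₂ n lam mu) * (e - β * g1) -
        (B₂ (n + 2) lam' mu' * B₂ n lam' mu') * g1'
    · have hy := h2 (right_ne_zero_of_mul hY)
      linear_combination c' * hy - B₄ n lam mu * e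
    · have hz := h3 (by simp only [mul_ne_zero_iff] at hZ ⊢; tauto)
      linear_combination c' * c3 * c3' * hz -
        (B₃ (n + 1) lam mu * B₃ n lam mu * B₂ (n + 1) lam' mu' * c3') * (c3 * e - β * g2) -
        (B₃ (n + 1) lam' mu' * B₃ n lam' mu' * B₂ (n + 1) lam mu * c3) * g2'

theorem cases_iff {n lam mu lam' mu' : ℂ}
    (h : falling (del lam mu - n) 4 ≠ 0) (h' : falling (del lam' mu' - n) 4 ≠ 0)
    (hs : SVC n lam mu lam' mu') :
    (∃ α : ℂ, α ≠ 0 ∧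
        (B₂ (n + 2) lam mu * B₂ n lam mu ≠ 0 →
          α * (B₂ (n + 2) lam mu * B₂ n lam mu) = B₂ (n + 2) lam' mu' * B₂ n lam' mu') ∧
        (B₄ n lam mu ≠ 0 → α * B₄ n lam mu = B₄ n lam' mu') ∧
        (B₃ (n + 1) lam mu * B₃ n lam mu * B₂ (n + 1) lam mu ≠ 0 →
          α * (B₃ (n + 1) lam mu * B₃ n lam mu * B₂ (n + 1) lam' mu') =
            B₃ (n + 1) lam' mu' * B₃ n lam' mu' * B₂ (n + 1) lam mu)) ↔
      CaseI n lam mu ∨ CaseII n lam mu lam' mu' ∨ CaseIII n lam mu lam' mu' ∨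
        CaseIV n lam mu lam' mu' ∨ CaseV n lam mu lam' mu' := by
  obtain ⟨h20, h31, h42, h30, h41, h40⟩ := (svc_iff_of_falling_ne_zero h h').1 hs
  rw [exists_scale_iff (by rw [mul_eq_zero, mul_eq_zero, h42, h20]) h40
    (by rw [mul_eq_zero, mul_eq_zero, h41, h30]) h31]
  have eK : ∀ l m, B₂ (n + 2) l m * B₂ n l m * B₂ (n + 1) l m / (B₃ (n + 1) l m * B₃ n l m) =
      invK n l m := fun l m => by rw [invK, mul_right_comm]
  rw [eK, eK]
  refine or_congr Iff.rfl (or_congr ?_ (or_congr ?_ (or_congr ?_ ?_))) <;>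
    refine and_congr (not_congr (Eq.congr_left ?_)) Iff.rfl <;> ring

theorem classification {n : ℂ} (hn : ¬ IsResonant 5 n) (lam mu lam' mu' : ℂ) :
    SQEquiv 5 (del lam mu - n) lam mu (del lam' mu' - n) lam' mu' ↔
      SVC n lam mu lam' mu' ∧
      (falling (del lam mu - n) 4 * falling (del lam' mu' - n) 4 = 0 ∨
        (falling (del lam mu - n) 4 * falling (del lam' mu' - n) 4 ≠ 0 ∧
          (CaseI n lam mu ∨ CaseII n lam mu lam' mu' ∨ CaseIII n lam mu lam' mu' ∨
            CaseIV n lam mu lam' mu' ∨ CaseV n lam mu lam' mu'))) := by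
  by_cases h : falling (del lam mu - n) 4 * falling (del lam' mu' - n) 4 = 0
  · rw [sqEquiv_iff_svc_of_falling_eq_zero hn _ _ _ _ h]
    simp only [h, true_or, and_true]
  · have h1 := left_ne_zero_of_mul h
    have h2 := right_ne_zero_of_mul h
    rw [sqEquiv_iff_of_falling_ne_zero hn h1 h2]
    simp only [h, false_or, ne_eq, not_false_eq_true, true_and]
    exact and_congr_right fun hs => cases_iff h1 h2 hs

theorem cases_pairwise (n lam mu lam' mu' : ℂ) :
    [CaseI n lam mu, CaseII n lam mu lam' mu', CaseIII n lam mu lam' mu', CaseIV n lam mu lam' mu',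
      CaseV n lam mu lam' mu'].Pairwise (fun P Q => ¬ (P ∧ Q)) := by
  simp only [List.pairwise_cons, List.mem_cons, List.not_mem_nil, or_false, forall_eq_or_imp,
    forall_eq, CaseI, CaseII, CaseIII, CaseIV, CaseV, ne_eq, mul_eq_zero, false_imp_iff,
    implies_true, List.Pairwise.nil, and_true]
  refine ⟨⟨?_, ?_, ?_, ?_⟩, ⟨?_, ?_, ?_⟩, ⟨?_, ?_⟩, ?_⟩ <;> tauto

theorem generic_of_svc {n lam mu lam' mu' : ℂ} (h : SVC n lam mu lam' mu')
    (hg : Generic n lam mu) : Generic n lam' mu' := by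
  obtain ⟨f4, hB⟩ := hg
  obtain ⟨f1, f2, f3, f4', f5⟩ := falling_ne_zero f4
  obtain ⟨h20, h31, h42, h30, h41, h40⟩ := h
  simp only [mul_ne_zero_iff] at hB
  obtain ⟨⟨⟨⟨⟨b40, b41⟩, b30⟩, b42⟩, b31⟩, b20⟩ := hB
  have n40 := (not_congr h40).1 (mul_ne_zero f4 b40)
  have n41 := (not_congr h41).1 (mul_ne_zero f4' b41)
  have n30 := (not_congr h30).1 (mul_ne_zero f2 b30)
  have n42 := (not_congr h42).1 (mul_ne_zero f5 b42)
  have n31 := (not_congr h31).1 (mul_ne_zero f3 b31)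
  have n20 := (not_congr h20).1 (mul_ne_zero f1 b20)
  refine ⟨left_ne_zero_of_mul n40, ?_⟩
  simp only [mul_ne_zero_iff]
  exact ⟨⟨⟨⟨⟨right_ne_zero_of_mul n40, right_ne_zero_of_mul n41⟩, right_ne_zero_of_mul n30⟩,
    right_ne_zero_of_mul n42⟩, right_ne_zero_of_mul n31⟩, right_ne_zero_of_mul n20⟩

theorem sqEquiv_iff_of_generic {n : ℂ} (hn : ¬ IsResonant 5 n) {lam mu lam' mu' : ℂ}
    (hg : Generic n lam mu) (hg' : Generic n lam' mu') :
    SQEquiv 5 (del lam mu - n) lam mu (del lam' mu' - n) lam' mu' ↔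
      invI n lam mu = invI n lam' mu' ∧ invJ n lam mu = invJ n lam' mu' := by
  obtain ⟨f, hB⟩ := hg
  obtain ⟨f', hB'⟩ := hg'
  have hB0 := hB
  have hs : SVC n lam mu lam' mu' := by
    rw [svc_iff_of_falling_ne_zero f f']
    simp only [mul_ne_zero_iff] at hB hB'
    tauto
  rw [classification hn, or_iff_right (mul_ne_zero f f')]
  simp only [hs, mul_ne_zero f f', ne_eq, not_false_eq_true, true_and]
  simp only [mul_ne_zero_iff] at hB
  have hI : ¬ CaseI n lam mu := by simp only [CaseI, mul_eq_zero]; tauto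
  have hII : ¬ CaseII n lam mu lam' mu' := by simp only [CaseII, mul_eq_zero]; tauto
  have hIII : ¬ CaseIII n lam mu lam' mu' := by simp only [CaseIII, mul_eq_zero]; tauto
  have hIV : ¬ CaseIV n lam mu lam' mu' := by simp only [CaseIV]; tauto
  simp only [hI, hII, hIII, hIV, false_or]
  rw [CaseV, and_iff_right hB0]

/-! ### Pencils of conics and cubics -/

section Pencils

open MvPolynomial (totalDegree IsHomogeneous)

theorem isHomogeneous_term (c : ℂ) (i j : ℕ) :
    (MvPolynomial.C c * MvPolynomial.X (0 : Fin 2) ^ i * MvPolynomial.X 1 ^ j).IsHomogeneous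
      (i + j) := by
  have h := ((MvPolynomial.isHomogeneous_C (Fin 2) c).mul
    (MvPolynomial.isHomogeneous_X_pow (R := ℂ) (0 : Fin 2) i)).mul
    (MvPolynomial.isHomogeneous_X_pow (R := ℂ) (1 : Fin 2) j)
  rwa [zero_add] at h

/-- The linear form `a γ + b δ`, with `γ = X 0` and `δ = X 1`. Exponents `0` and `1` are written out
so that every term has the shape of `isHomogeneous_term`. -/
def linForm (a b : ℂ) : MvPolynomial (Fin 2) ℂ :=
  MvPolynomial.C a * MvPolynomial.X 0 ^ 1 * MvPolynomial.X 1 ^ 0 +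
    MvPolynomial.C b * MvPolynomial.X 0 ^ 0 * MvPolynomial.X 1 ^ 1

/-- The quadratic form `a γ² + b γ δ + c δ²`. -/
def quadForm (a b c : ℂ) : MvPolynomial (Fin 2) ℂ :=
  MvPolynomial.C a * MvPolynomial.X 0 ^ 2 * MvPolynomial.X 1 ^ 0 +
    MvPolynomial.C b * MvPolynomial.X 0 ^ 1 * MvPolynomial.X 1 ^ 1 +
    MvPolynomial.C c * MvPolynomial.X 0 ^ 0 * MvPolynomial.X 1 ^ 2

/-- The cubic form `a γ³ + b γ² δ + c γ δ²`; no `δ³` occurs in the pencil of cubics. -/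
def cubeForm (a b c : ℂ) : MvPolynomial (Fin 2) ℂ :=
  MvPolynomial.C a * MvPolynomial.X 0 ^ 3 * MvPolynomial.X 1 ^ 0 +
    MvPolynomial.C b * MvPolynomial.X 0 ^ 2 * MvPolynomial.X 1 ^ 1 +
    MvPolynomial.C c * MvPolynomial.X 0 ^ 1 * MvPolynomial.X 1 ^ 2

theorem isHomogeneous_linForm (a b : ℂ) : (linForm a b).IsHomogeneous 1 :=
  (isHomogeneous_term a 1 0).add (isHomogeneous_term b 0 1)

theorem isHomogeneous_quadForm (a b c : ℂ) : (quadForm a b c).IsHomogeneous 2 :=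
  ((isHomogeneous_term a 2 0).add (isHomogeneous_term b 1 1)).add (isHomogeneous_term c 0 2)

theorem isHomogeneous_cubeForm (a b c : ℂ) : (cubeForm a b c).IsHomogeneous 3 :=
  ((isHomogeneous_term a 3 0).add (isHomogeneous_term b 2 1)).add (isHomogeneous_term c 1 2)

theorem eval_linForm (a b x y : ℂ) : MvPolynomial.eval ![x, y] (linForm a b) = a * x + b * y := by
  simp [linForm]

theorem eval_quadForm (a b c x y : ℂ) :
    MvPolynomial.eval ![x, y] (quadForm a b c) = a * x ^ 2 + b * (x * y) + c * y ^ 2 := by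
  simp [quadForm, mul_assoc]

theorem eval_cubeForm (a b c x y : ℂ) : MvPolynomial.eval ![x, y] (cubeForm a b c) =
    a * x ^ 3 + b * (x ^ 2 * y) + c * (x * y ^ 2) := by
  simp [cubeForm, mul_assoc]

theorem totalDegree_add_of_isHomogeneous {σ : Type*} {p q : MvPolynomial σ ℂ} {d : ℕ}
    (hp : p.IsHomogeneous d) (hp0 : p ≠ 0)
    (hq : q.totalDegree < d) : (p + q).totalDegree = d := by
  rw [MvPolynomial.totalDegree_add_eq_left_of_totalDegree_lt (by rwa [hp.totalDegree hp0]),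
    hp.totalDegree hp0]

/-- The polynomial `a γ² + b γ δ + c δ² + d γ + e δ + f`. -/
def conic (a b c d e f : ℂ) : MvPolynomial (Fin 2) ℂ :=
  quadForm a b c + (linForm d e + MvPolynomial.C f)

theorem totalDegree_conic {a b c : ℂ} (d e f : ℂ) (h : a ≠ 0 ∨ c ≠ 0) :
    (conic a b c d e f).totalDegree = 2 := by
  refine totalDegree_add_of_isHomogeneous (isHomogeneous_quadForm a b c) (fun h0 => ?_) ?_
  · have h1 := eval_quadForm a b c 1 0
    have h2 := eval_quadForm a b c 0 1
    rw [h0, map_zero] at h1 h2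
    norm_num at h1 h2
    rcases h with h | h
    · exact h h1.symm
    · exact h h2.symm
  · refine (MvPolynomial.totalDegree_add _ _).trans_lt (max_lt ?_ ?_)
    · exact (isHomogeneous_linForm d e).totalDegree_le.trans_lt (by norm_num)
    · rw [MvPolynomial.totalDegree_C]; norm_num

theorem totalDegree_conic_lt (a b c d e f : ℂ) : (conic a b c d e f).totalDegree < 3 := by
  refine (MvPolynomial.totalDegree_add _ _).trans_lt (max_lt ?_
    ((MvPolynomial.totalDegree_add _ _).trans_lt (max_lt ?_ ?_)))
  · exact (isHomogeneous_quadForm a b c).totalDegree_le.trans_lt (by norm_num)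
  · exact (isHomogeneous_linForm d e).totalDegree_le.trans_lt (by norm_num)
  · rw [MvPolynomial.totalDegree_C]; norm_num

theorem totalDegree_cubic {a b c : ℂ} (d e f g h k : ℂ) (hne : a ≠ 0 ∨ c ≠ 0) :
    (cubeForm a b c + conic d e f g h k).totalDegree = 3 := by
  refine totalDegree_add_of_isHomogeneous (isHomogeneous_cubeForm a b c) (fun h0 => ?_)
    (totalDegree_conic_lt _ _ _ _ _ _)
  have h1 := eval_cubeForm a b c 1 0
  have h2 := eval_cubeForm a b c 1 1
  have h3 := eval_cubeForm a b c 1 (-1)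
  rw [h0, map_zero] at h1 h2 h3
  have ha : a = 0 := by linear_combination -h1
  rcases hne with h | h
  · exact h ha
  · exact h (by linear_combination -h2 / 2 - h3 / 2 - ha)

end Pencils

/-- `B_{n+4,n}` as a polynomial in `(γ, δ)`. -/
def conicP (n : ℂ) : MvPolynomial (Fin 2) ℂ :=
  conic 1 (-2 * (2 * n + 3)) 0 (2 * n ^ 2 + 6 * n - 3) (-3 / 5 * n * (n + 3) * (2 * (2 * n + 3)))
    (-3 / 5 * n * (n + 3) * (n ^ 2 + 3 * n + 6))

/-- `B_{n+4,n+2} B_{n+2,n}` as a polynomial in `(γ, δ)`. -/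
def conicQ (n : ℂ) : MvPolynomial (Fin 2) ℂ :=
  conic 1 (-(4 * n + 6)) ((2 * n + 5) * (2 * n + 1))
    (-(n ^ 2 + n + 1 + ((n + 2) ^ 2 + (n + 2) + 1)))
    ((2 * n + 5) * (n ^ 2 + n + 1) + (2 * n + 1) * ((n + 2) ^ 2 + (n + 2) + 1))
    ((n ^ 2 + n + 1) * ((n + 2) ^ 2 + (n + 2) + 1))

theorem eval_conic (a b c d e f x y : ℂ) : MvPolynomial.eval ![x, y] (conic a b c d e f) =
    a * x ^ 2 + b * (x * y) + c * y ^ 2 + (d * x + e * y + f) := by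
  rw [conic, map_add, map_add, eval_quadForm, eval_linForm, MvPolynomial.eval_C]

theorem eval_conicP (n lam mu : ℂ) :
    MvPolynomial.eval ![gam lam mu, del lam mu] (conicP n) = B₄ n lam mu := by
  rw [conicP, eval_conic, B₄]; ring

theorem eval_conicQ (n lam mu : ℂ) :
    MvPolynomial.eval ![gam lam mu, del lam mu] (conicQ n) =
      B₂ (n + 2) lam mu * B₂ n lam mu := by
  rw [conicQ, eval_conic, B₂, B₂]; ring

theorem conic_pencil (s t a b c d e f a' b' c' d' e' f' : ℂ) :
    s • conic a b c d e f + t • conic a' b' c' d' e' f' =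
      conic (s * a + t * a') (s * b + t * b') (s * c + t * c') (s * d + t * d') (s * e + t * e')
        (s * f + t * f') := by
  simp only [conic, quadForm, linForm, MvPolynomial.smul_eq_C_mul, map_add, map_mul]
  ring

theorem totalDegree_pencil_conic {n : ℂ} (hn : ¬ IsResonant 5 n) (a b : ℂ)
    (hab : (a, b) ≠ (0, 0)) : (a • conicP n + b • conicQ n).totalDegree = 2 := by
  rw [conicP, conicQ, conic_pencil]
  apply totalDegree_conic
  by_contra! h
  have h1 := two_mul_add_ne_zero_of_not_isResonant hn 0 1 (by norm_num)
  have h5 := two_mul_add_ne_zero_of_not_isResonant hn 0 5 (by norm_num)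
  simp only [Nat.cast_zero, add_zero, Nat.cast_one, Nat.cast_ofNat] at h1 h5
  have hb : b = 0 := by
    refine (mul_eq_zero.1 (?_ : b * ((2 * n + 5) * (2 * n + 1)) = 0)).resolve_right
      (mul_ne_zero h5 h1)
    linear_combination h.2
  exact hab (Prod.ext (by linear_combination h.1 - hb) hb)

/-- `B_{n+4,n} B_{n+3,n+1}` as a polynomial in `(γ, δ)`. -/
def cubicR (n : ℂ) : MvPolynomial (Fin 2) ℂ :=
  conicP n * (linForm 1 (-(2 * n + 3)) + MvPolynomial.C (-((n + 1) ^ 2 + (n + 1) + 1)))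

/-- `B_{n+4,n+1} B_{n+3,n}` as a polynomial in `(γ, δ)`: each factor is `γ^(1/2)` times a polynomial
of degree one. -/
def cubicS (n : ℂ) : MvPolynomial (Fin 2) ℂ :=
  cubeForm 1 (-3 * (2 * n + 3)) (9 * (n + 1) * (n + 2)) +
    conic (-6) (9 * (2 * n + 3)) 0 9 0 0

theorem eval_cubicR (n lam mu : ℂ) :
    MvPolynomial.eval ![gam lam mu, del lam mu] (cubicR n) =
      B₄ n lam mu * B₂ (n + 1) lam mu := by
  rw [cubicR, map_mul, eval_conicP, map_add, eval_linForm, MvPolynomial.eval_C, B₂]; ring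

theorem eval_cubicS (n lam mu : ℂ) :
    MvPolynomial.eval ![gam lam mu, del lam mu] (cubicS n) =
      B₃ (n + 1) lam mu * B₃ n lam mu := by
  rw [cubicS, map_add, eval_cubeForm, eval_conic, B₃, B₃, ← gamSqrt_sq]; ring

theorem conic_mul_line (b d e f m r : ℂ) :
    conic 1 b 0 d e f * (linForm 1 m + MvPolynomial.C r) =
      cubeForm 1 (b + m) (b * m) +
        conic (d + r) (e + d * m + b * r) (e * m) (f + d * r) (f * m + e * r) (f * r) := by
  simp only [conic, cubeForm, quadForm, linForm, map_add, map_mul, map_one, map_zero]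
  ring

theorem totalDegree_pencil_cubic {n : ℂ} (hn : ¬ IsResonant 5 n) (a b : ℂ)
    (hab : (a, b) ≠ (0, 0)) : (a • cubicR n + b • cubicS n).totalDegree = 3 := by
  have hc : ∀ a b c a' b' c' s t : ℂ, s • cubeForm a b c + t • cubeForm a' b' c' =
      cubeForm (s * a + t * a') (s * b + t * b') (s * c + t * c') := by
    intros
    simp only [cubeForm, MvPolynomial.smul_eq_C_mul, map_add, map_mul]
    ring
  rw [cubicR, conicP, conic_mul_line, cubicS, smul_add, smul_add, add_add_add_comm, hc,
    conic_pencil]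
  apply totalDegree_cubic
  by_contra! h
  have h0 := two_mul_add_ne_zero_of_not_isResonant hn 0 0 (by norm_num)
  have h6 := two_mul_add_ne_zero_of_not_isResonant hn 0 6 (by norm_num)
  simp only [Nat.cast_zero, add_zero, Nat.cast_ofNat] at h0 h6
  have hb : b = 0 := by
    refine (mul_eq_zero.1 (?_ : b * (2 * n * (2 * n + 6)) = 0)).resolve_right
      (mul_ne_zero h0 h6)
    linear_combination 4 * h.2 - 4 * 2 * (2 * n + 3) ^ 2 * h.1
  exact hab (Prod.ext (by linear_combination h.1 - hb) hb)

theorem EC_eq_of_generic {n : ℂ} (hn : ¬ IsResonant 5 n) {lam mu : ℂ} (hg : Generic n lam mu) :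
    EC 5 n lam mu =
      {p | (∃ lam' mu' : ℂ, p = (gam lam' mu', del lam' mu') ∧ Generic n lam' mu') ∧
        MvPolynomial.eval ![p.1, p.2] ((B₂ (n + 2) lam mu * B₂ n lam mu) • conicP n
          - B₄ n lam mu • conicQ n) = 0 ∧
        MvPolynomial.eval ![p.1, p.2] ((B₃ (n + 1) lam mu * B₃ n lam mu) • cubicR n
          - (B₄ n lam mu * B₂ (n + 1) lam mu) • cubicS n) = 0} := by
  have inv_iff : ∀ lam' mu', Generic n lam' mu' →
      ((invI n lam' mu' = invI n lam mu ∧ invJ n lam' mu' = invJ n lam mu) ↔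
        MvPolynomial.eval ![gam lam' mu', del lam' mu']
          ((B₂ (n + 2) lam mu * B₂ n lam mu) • conicP n - B₄ n lam mu • conicQ n) = 0 ∧
        MvPolynomial.eval ![gam lam' mu', del lam' mu']
          ((B₃ (n + 1) lam mu * B₃ n lam mu) • cubicR n
            - (B₄ n lam mu * B₂ (n + 1) lam mu) • cubicS n) = 0) := by
    intro lam' mu' hg'
    have hB := hg.2
    have hB' := hg'.2
    simp only [mul_ne_zero_iff] at hB hB'
    obtain ⟨⟨⟨⟨⟨-, b41⟩, b30⟩, b42⟩, -⟩, b20⟩ := hB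
    obtain ⟨⟨⟨⟨⟨-, b41'⟩, b30'⟩, b42'⟩, -⟩, b20'⟩ := hB'
    simp only [map_sub, MvPolynomial.smul_eval, eval_conicP, eval_conicQ, eval_cubicR, eval_cubicS,
      invI, invJ, sub_eq_zero]
    rw [div_eq_div_iff (mul_ne_zero b42' b20') (mul_ne_zero b42 b20),
      div_eq_div_iff (mul_ne_zero b41' b30') (mul_ne_zero b41 b30),
      mul_comm (B₄ n lam' mu'), mul_comm (B₄ n lam' mu' * B₂ (n + 1) lam' mu')]
  ext p
  constructor
  · rintro ⟨lam', mu', rfl, h⟩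
    have hg' : Generic n lam' mu' := by
      obtain ⟨h20, h31, h42, h30, h41, h40⟩ := ((classification hn _ _ _ _).1 h).1
      exact generic_of_svc ⟨h20.symm, h31.symm, h42.symm, h30.symm, h41.symm, h40.symm⟩ hg
    exact ⟨⟨lam', mu', rfl, hg'⟩,
      (inv_iff lam' mu' hg').1 ((sqEquiv_iff_of_generic hn hg' hg).1 h)⟩
  · rintro ⟨⟨lam', mu', rfl, hg'⟩, h⟩
    exact ⟨lam', mu', rfl, (sqEquiv_iff_of_generic hn hg' hg).2 ((inv_iff lam' mu' hg').2 h)⟩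

end PseudoDiff

end

theorem mainTheorem1 (n : ℂ) (hn : ¬ PseudoDiff.IsResonant 5 n) :
    -- the classification
    (∀ lam mu lam' mu' : ℂ,
      (PseudoDiff.SQEquiv 5 (PseudoDiff.del lam mu - n) lam mu
          (PseudoDiff.del lam' mu' - n) lam' mu' ↔
        PseudoDiff.SVC n lam mu lam' mu' ∧
        (PseudoDiff.falling (PseudoDiff.del lam mu - n) 4 *
            PseudoDiff.falling (PseudoDiff.del lam' mu' - n) 4 = 0 ∨
          (PseudoDiff.falling (PseudoDiff.del lam mu - n) 4 *
              PseudoDiff.falling (PseudoDiff.del lam' mu' - n) 4 ≠ 0 ∧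
            (PseudoDiff.CaseI n lam mu ∨
              PseudoDiff.CaseII n lam mu lam' mu' ∨
              PseudoDiff.CaseIII n lam mu lam' mu' ∨
              PseudoDiff.CaseIV n lam mu lam' mu' ∨
              PseudoDiff.CaseV n lam mu lam' mu'))))) ∧
    -- the five conditions are mutually exclusive
    (∀ lam mu lam' mu' : ℂ,
      [PseudoDiff.CaseI n lam mu, PseudoDiff.CaseII n lam mu lam' mu',
        PseudoDiff.CaseIII n lam mu lam' mu', PseudoDiff.CaseIV n lam mu lam' mu',
        PseudoDiff.CaseV n lam mu lam' mu'].Pairwise (fun P Q => ¬ (P ∧ Q))) ∧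
    -- on the generic locus the two rational invariants are complete
    (∀ lam mu lam' mu' : ℂ,
      PseudoDiff.Generic n lam mu → PseudoDiff.Generic n lam' mu' →
        (PseudoDiff.SQEquiv 5 (PseudoDiff.del lam mu - n) lam mu
            (PseudoDiff.del lam' mu' - n) lam' mu' ↔
          PseudoDiff.invI n lam mu = PseudoDiff.invI n lam' mu' ∧
          PseudoDiff.invJ n lam mu = PseudoDiff.invJ n lam' mu')) ∧
    -- generic classes are cut out by a pencil of conics `P, Q` and a pencil of cubics `R, S`
    (∃ P Q R S : MvPolynomial (Fin 2) ℂ,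
      (∀ lam mu : ℂ,
        MvPolynomial.eval ![PseudoDiff.gam lam mu, PseudoDiff.del lam mu] P =
          PseudoDiff.B₄ n lam mu ∧
        MvPolynomial.eval ![PseudoDiff.gam lam mu, PseudoDiff.del lam mu] Q =
          PseudoDiff.B₂ (n + 2) lam mu * PseudoDiff.B₂ n lam mu ∧
        MvPolynomial.eval ![PseudoDiff.gam lam mu, PseudoDiff.del lam mu] R =
          PseudoDiff.B₄ n lam mu * PseudoDiff.B₂ (n + 1) lam mu ∧
        MvPolynomial.eval ![PseudoDiff.gam lam mu, PseudoDiff.del lam mu] S =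
          PseudoDiff.B₃ (n + 1) lam mu * PseudoDiff.B₃ n lam mu) ∧
      (∀ a b : ℂ, (a, b) ≠ (0, 0) → (a • P + b • Q).totalDegree = 2) ∧
      (∀ a b : ℂ, (a, b) ≠ (0, 0) → (a • R + b • S).totalDegree = 3) ∧
      (∀ lam mu : ℂ, PseudoDiff.Generic n lam mu →
        PseudoDiff.EC 5 n lam mu =
          {p | (∃ lam' mu' : ℂ, p = (PseudoDiff.gam lam' mu', PseudoDiff.del lam' mu') ∧
                PseudoDiff.Generic n lam' mu') ∧
              MvPolynomial.eval ![p.1, p.2]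
                ((PseudoDiff.B₂ (n + 2) lam mu * PseudoDiff.B₂ n lam mu) • P
                  - PseudoDiff.B₄ n lam mu • Q) = 0 ∧
              MvPolynomial.eval ![p.1, p.2]
                ((PseudoDiff.B₃ (n + 1) lam mu * PseudoDiff.B₃ n lam mu) • R
                  - (PseudoDiff.B₄ n lam mu * PseudoDiff.B₂ (n + 1) lam mu) • S) = 0})) := by
  open PseudoDiff in
  exact ⟨classification hn, cases_pairwise n,
    fun _ _ _ _ hg hg' => sqEquiv_iff_of_generic hn hg hg',
    conicP n, conicQ n, cubicR n, cubicS n,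
    fun lam mu => ⟨eval_conicP n lam mu, eval_conicQ n lam mu, eval_cubicR n lam mu,
      eval_cubicS n lam mu⟩,
    totalDegree_pencil_conic hn, totalDegree_pencil_cubic hn, fun _ _ hg => EC_eq_of_generic hn hg⟩
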